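/- Let $\Sigma\subset S^2$ be a set of twelve points on the unit sphere with pairwise spherical distances at least $\pi/3$, and let $\mathcal S(\Sigma)$ be the associated spherical configuration (a Type-I configuration), whose faces are the radial projections of the faces of the convex hull of $\Sigma$. The star of a vertex $N\in\Sigma$ is the collection of all faces of $\mathcal S(\Sigma)$ having $N$ as a vertex; it is of type $\{\triangle,\square,\triangle,\square\}$ if it consists of exactly four faces which are, in cyclic order around $N$, a spherical equilateral triangle with sides $\pi/3$, a spherical square with sides $\pi/3$, a spherical equilateral triangle with sides $\pi/3$, and a spherical square with sides $\pi/3$. Suppose that some vertex of $\mathcal S(\Sigma)$ has a star of type $\{\triangle,\square,\triangle,\square\}$. Then, up to an orthogonal transformation of $\mathbb R^3$, $\Sigma$ is either - the f.c.c. configuration, that is, the vertices of a cuboctahedron: $\frac{1}{\sqrt2}(\pm1,\pm1,0)$, $\frac{1}{\sqrt2}(\pm1,0,\pm1)$, $\frac{1}{\sqrt2}(0,\pm1,\pm1)$; or - the h.c.p. configuration: $(\pm1,0,0)$, $(\pm\frac12,\pm\frac{\sqrt3}{2},0)$, $(\pm\frac12,\frac{\sqrt3}{6},\pm\frac{\sqrt6}{3})$,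 $(0,-\frac{\sqrt3}{3},\pm\frac{\sqrt6}{3})$. (All combinations of signs are taken.) -/

import Mathlib

/-- Euclidean three-space; the unit sphere `S²` is `Metric.sphere (0 : E3) 1`, and the spherical
distance of two of its points is the angle between them. -/
abbrev E3 : Type := EuclideanSpace ℝ (Fin 3)

/-- Vertex sets of Type-I configurations: twelve points of `S²` with pairwise spherical distance at
least `π / 3`. -/
def IsTypeI (S : Set E3) : Prop :=
  S ⊆ Metric.sphere (0 : E3) 1 ∧ S.ncard = 12 ∧
    S.Pairwise fun x y => Real.pi / 3 ≤ InnerProductGeometry.angle x y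

/-- `F` is the set of vertices of a face of the spherical configuration of `S`. The faces of that
configuration are the radial projections of the two-dimensional faces `G` of the polyhedron
`convexHull ℝ S`; for `S` on the sphere, the vertices of `G` are the points of `S` in `G`. -/
def IsFace (S F : Set E3) : Prop :=
  ∃ G : Set E3, IsExposed ℝ (convexHull ℝ S) G ∧ Module.finrank ℝ (vectorSpan ℝ G) = 2 ∧
    F = S ∩ G

/-- The star of `N`: the faces (given by their vertex sets) that have `N` as a vertex. -/
def starAt (S : Set E3) (N : E3) : Set (Set E3) :=
  {F | IsFace S F ∧ N ∈ F}

/-- `a, b, c` are the vertices of a `π / 3`-equilateral spherical triangle. -/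
def IsTriangle (a b c : E3) : Prop :=
  InnerProductGeometry.angle a b = Real.pi / 3 ∧ InnerProductGeometry.angle b c = Real.pi / 3 ∧
    InnerProductGeometry.angle c a = Real.pi / 3

/-- `a, b, c, d` are, in cyclic order, the vertices of a `π / 3`-square: a spherical quadrilateral
with four sides `π / 3` and equal diagonals. -/
def IsSquare4 (a b c d : E3) : Prop :=
  InnerProductGeometry.angle a b = Real.pi / 3 ∧ InnerProductGeometry.angle b c = Real.pi / 3 ∧
    InnerProductGeometry.angle c d = Real.pi / 3 ∧ InnerProductGeometry.angle d a = Real.pi / 3 ∧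
    InnerProductGeometry.angle a c = InnerProductGeometry.angle b d

/-- The star of `N` is of type `{△, □, △, □}`: it consists of exactly four faces, in cyclic order
the triangle `N A B`, the square `N B W C`, the triangle `N C D` and the square `N D E A`, where
consecutive faces share the edges `N B`, `N C`, `N D` and `N A`. -/
def IsStarTSTS (S : Set E3) (N : E3) : Prop :=
  ∃ A B W C D E : E3,
    starAt S N = {{N, A, B}, {N, B, W, C}, {N, C, D}, {N, D, E, A}} ∧
    IsTriangle N A B ∧ IsSquare4 N B W C ∧ IsTriangle N C D ∧ IsSquare4 N D E A

/-- The f.c.c. configuration: the vertices of a cuboctahedron. -/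
noncomputable def fccConfig : Set E3 :=
  (fun v : E3 => (√2)⁻¹ • v) ''
    {!₂[1, 1, 0], !₂[1, -1, 0], !₂[-1, 1, 0], !₂[-1, -1, 0],
     !₂[1, 0, 1], !₂[1, 0, -1], !₂[-1, 0, 1], !₂[-1, 0, -1],
     !₂[0, 1, 1], !₂[0, 1, -1], !₂[0, -1, 1], !₂[0, -1, -1]}

/-- The h.c.p. configuration: a regular hexagon on the equator, and above and below it two
equilateral triangles that are mirror images in the equatorial plane. -/
noncomputable def hcpConfig : Set E3 :=
  {!₂[1, 0, 0], !₂[-1, 0, 0],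
   !₂[1 / 2, √3 / 2, 0], !₂[-1 / 2, √3 / 2, 0], !₂[1 / 2, -√3 / 2, 0], !₂[-1 / 2, -√3 / 2, 0],
   !₂[1 / 2, √3 / 6, √6 / 3], !₂[-1 / 2, √3 / 6, √6 / 3], !₂[0, -√3 / 3, √6 / 3],
   !₂[1 / 2, √3 / 6, -√6 / 3], !₂[-1 / 2, √3 / 6, -√6 / 3], !₂[0, -√3 / 3, -√6 / 3]}

/-- Congruence of point sets on the sphere: an orthogonal transformation maps one to the other. -/
def CongruentOnSphere (S T : Set E3) : Prop :=
  ∃ g : E3 ≃ₗᵢ[ℝ] E3, g '' T = S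

/-! The star fixes seven of the twelve points up to isometry: `W` and `E` are antipodal, and with
the line through them as axis, `N` is on the equator and `A`, `B`, `C`, `D` are at distance π/3 from
the poles (`exists_isometry_frame`). The other five points keep distance π/3 from both poles, so
they lie in the strip of height at most 1/2 around the equator and are described by longitude and
height.

For two points of the strip, the distance condition implies a lower bound on the difference of
longitudes that depends only on the product of the heights. In units of `magic`, with heights scaled
to [0, 1] and k = `excess`, concavity simplifies it to 1 + k h h' for points on the same side of the
equator and to √(1 - h h') for points on opposite sides. Both simplifications are exact at h h' = 0
and h h' = 1, so nothing is lost at the extremal configurations. The seven fixed points confine a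
longitude s to |s| ≤ 1 + k - k h. This interval has length less than 3, so each side holds at most
three of the five points, and they split as three and two.

What remains is a packing problem on a line (`StripPacking.classification`). For each way in which
the two rows interleave, the room is so tight that the defects 1 - h of the heights that should be 1
must vanish, mostly because their maximum δ satisfies δ ≤ (M δ)² with M² δ < 1. The points then form
two pairs, one point above the other, and a single equatorial point. The order pair, single, pair
gives the cuboctahedron; single at either end gives the h.c.p. configuration. -/

/-! ### Packing three and two points in a strip: real inequalities -/

/-- Constraints on five points of the strip, three on one side of the central circle (positions
`p₁, p₂, p₃`, heights `P₁, P₂, P₃`) and two on the other side (positions `q₁, q₂`, heights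
`Q₁, Q₂`). Positions and heights are normalised. -/
structure StripPacking (k P₁ P₂ P₃ Q₁ Q₂ p₁ p₂ p₃ q₁ q₂ : ℝ) : Prop where
  k_pos : 0 < k
  k_le : k ≤ 3 / 10
  P₁_mem : P₁ ∈ Set.Icc (0 : ℝ) 1
  P₂_mem : P₂ ∈ Set.Icc (0 : ℝ) 1
  P₃_mem : P₃ ∈ Set.Icc (0 : ℝ) 1
  Q₁_mem : Q₁ ∈ Set.Icc (0 : ℝ) 1
  Q₂_mem : Q₂ ∈ Set.Icc (0 : ℝ) 1
  p₁_low : -(1 + k) + k * P₁ ≤ p₁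
  p₁₂ : 1 + k * (P₁ * P₂) ≤ p₂ - p₁
  p₂₃ : 1 + k * (P₂ * P₃) ≤ p₃ - p₂
  p₃_high : p₃ ≤ 1 + k - k * P₃
  q₁_low : -(1 + k) + k * Q₁ ≤ q₁
  q₁₂ : 1 + k * (Q₁ * Q₂) ≤ q₂ - q₁
  q₂_high : q₂ ≤ 1 + k - k * Q₂
  p₁q₁ : 1 - P₁ * Q₁ ≤ (p₁ - q₁) ^ 2
  p₂q₁ : 1 - P₂ * Q₁ ≤ (p₂ - q₁) ^ 2
  p₃q₁ : 1 - P₃ * Q₁ ≤ (p₃ - q₁) ^ 2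
  p₁q₂ : 1 - P₁ * Q₂ ≤ (p₁ - q₂) ^ 2
  p₂q₂ : 1 - P₂ * Q₂ ≤ (p₂ - q₂) ^ 2
  p₃q₂ : 1 - P₃ * Q₂ ≤ (p₃ - q₂) ^ 2

theorem StripPacking.mirror {k P₁ P₂ P₃ Q₁ Q₂ p₁ p₂ p₃ q₁ q₂ : ℝ}
    (h : StripPacking k P₁ P₂ P₃ Q₁ Q₂ p₁ p₂ p₃ q₁ q₂) :
    StripPacking k P₃ P₂ P₁ Q₂ Q₁ (-p₃) (-p₂) (-p₁) (-q₂) (-q₁) where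
  k_pos := h.k_pos
  k_le := h.k_le
  P₁_mem := h.P₃_mem
  P₂_mem := h.P₂_mem
  P₃_mem := h.P₁_mem
  Q₁_mem := h.Q₂_mem
  Q₂_mem := h.Q₁_mem
  p₁_low := by linarith [h.p₃_high]
  p₁₂ := by linarith [h.p₂₃, mul_comm P₂ P₃]
  p₂₃ := by linarith [h.p₁₂, mul_comm P₁ P₂]
  p₃_high := by linarith [h.p₁_low]
  q₁_low := by linarith [h.q₂_high]
  q₁₂ := by linarith [h.q₁₂, mul_comm Q₁ Q₂]
  q₂_high := by linarith [h.q₁_low]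
  p₁q₁ := by linarith [h.p₃q₂]
  p₂q₁ := by linarith [h.p₂q₂]
  p₃q₁ := by linarith [h.p₁q₂]
  p₁q₂ := by linarith [h.p₃q₁]
  p₂q₂ := by linarith [h.p₂q₁]
  p₃q₂ := by linarith [h.p₁q₁]

/-- The cubic arrangement: pair, single point, pair. -/
def StripCubic (P₁ P₂ P₃ Q₁ Q₂ p₁ p₂ p₃ q₁ q₂ : ℝ) : Prop :=
  P₁ = 1 ∧ P₂ = 0 ∧ P₃ = 1 ∧ Q₁ = 1 ∧ Q₂ = 1 ∧ p₁ = -1 ∧ p₂ = 0 ∧ p₃ = 1 ∧ q₁ = -1 ∧ q₂ = 1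

/-- The hexagonal arrangement: pair, pair, single point. -/
def StripHexagonal (k P₁ P₂ P₃ Q₁ Q₂ p₁ p₂ p₃ q₁ q₂ : ℝ) : Prop :=
  P₁ = 1 ∧ P₂ = 1 ∧ P₃ = 0 ∧ Q₁ = 1 ∧ Q₂ = 1 ∧
    p₁ = -1 ∧ p₂ = k ∧ p₃ = 1 + k ∧ q₁ = -1 ∧ q₂ = k

theorem StripCubic.of_mirror {P₁ P₂ P₃ Q₁ Q₂ p₁ p₂ p₃ q₁ q₂ : ℝ}
    (h : StripCubic P₃ P₂ P₁ Q₂ Q₁ (-p₃) (-p₂) (-p₁) (-q₂) (-q₁)) :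
    StripCubic P₁ P₂ P₃ Q₁ Q₂ p₁ p₂ p₃ q₁ q₂ := by
  obtain ⟨h1, h2, h3, h4, h5, h6, h7, h8, h9, h10⟩ := h
  exact ⟨h3, h2, h1, h5, h4, by linarith, by linarith, by linarith, by linarith, by linarith⟩

theorem mul_mem_le {a b : ℝ} (ha : a ∈ Set.Icc (0 : ℝ) 1) (hb : b ∈ Set.Icc (0 : ℝ) 1) :
    0 ≤ a * b ∧ a * b ≤ a ∧ a * b ≤ b ∧ a + b - 1 ≤ a * b := by
  obtain ⟨a0, a1⟩ := ha
  obtain ⟨b0, b1⟩ := hb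
  refine ⟨by positivity, by nlinarith, by nlinarith, by nlinarith⟩

/-- Contraction principle: four defects bounded by the squares of `c δ`, where `δ` is the largest
of them, vanish. -/
theorem defects_eq_zero {a b c d x y M : ℝ}
    (ha : 0 ≤ a) (hb : 0 ≤ b) (hc : 0 ≤ c) (hd : 0 ≤ d)
    (ax : a ≤ x ^ 2) (bx : b ≤ x ^ 2) (cy : c ≤ y ^ 2) (dy : d ≤ y ^ 2)
    (hsmall : ∀ δ, a ≤ δ → b ≤ δ → c ≤ δ → d ≤ δ → 0 ≤ δ → |x| ≤ M * δ ∧ |y| ≤ M * δ)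
    (hx : M ^ 2 * a < 1) (hx2 : M ^ 2 * b < 1) (hx3 : M ^ 2 * c < 1) (hx4 : M ^ 2 * d < 1) :
    a = 0 ∧ b = 0 ∧ c = 0 ∧ d = 0 := by
  set δ := max (max a b) (max c d) with hδ
  have h1 : a ≤ δ := le_trans (le_max_left _ _) (le_max_left _ _)
  have h2 : b ≤ δ := le_trans (le_max_right _ _) (le_max_left _ _)
  have h3 : c ≤ δ := le_trans (le_max_left _ _) (le_max_right _ _)
  have h4 : d ≤ δ := le_trans (le_max_right _ _) (le_max_right _ _)
  have h0 : 0 ≤ δ := ha.trans h1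
  have hlt : M ^ 2 * δ < 1 := by
    rcases max_choice (max a b) (max c d) with h | h <;> rw [hδ, h]
    · rcases max_choice a b with h | h <;> rwa [h]
    · rcases max_choice c d with h | h <;> rwa [h]
  obtain ⟨hx, hy⟩ := hsmall δ h1 h2 h3 h4 h0
  have hx2 : x ^ 2 ≤ (M * δ) ^ 2 := sq_le_sq' (by linarith [neg_abs_le x]) (by linarith [le_abs_self x])
  have hy2 : y ^ 2 ≤ (M * δ) ^ 2 := sq_le_sq' (by linarith [neg_abs_le y]) (by linarith [le_abs_self y])
  have hle : δ ≤ (M * δ) ^ 2 := by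
    rw [hδ]
    refine max_le (max_le ?_ ?_) (max_le ?_ ?_) <;> rw [← hδ] <;> linarith
  have : δ = 0 := by
    by_contra hne
    have hpos : 0 < δ := lt_of_le_of_ne h0 (Ne.symm hne)
    nlinarith only [hpos, hle, hlt]
  refine ⟨?_, ?_, ?_, ?_⟩ <;> linarith

/-- The second lower point precedes the middle upper point. -/
theorem StripPacking.hexagonal_of_le {k P₁ P₂ P₃ Q₁ Q₂ p₁ p₂ p₃ q₁ q₂ : ℝ}
    (h : StripPacking k P₁ P₂ P₃ Q₁ Q₂ p₁ p₂ p₃ q₁ q₂) (hq : q₂ ≤ p₂) :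
    StripHexagonal k P₁ P₂ P₃ Q₁ Q₂ p₁ p₂ p₃ q₁ q₂ := by
  obtain ⟨kp, k1, hP1, hP2, hP3, hQ1, hQ2, e1, e2, e3, e4, e5, e6, e7, f1, f2, f3, f4, f5, f6⟩ := h
  have k0 := kp.le
  obtain ⟨a1, a2, a3, a4⟩ := mul_mem_le hP1 hP2
  obtain ⟨b1, b2, b3, b4⟩ := mul_mem_le hP2 hP3
  obtain ⟨c1, c2, c3, c4⟩ := mul_mem_le hQ1 hQ2
  obtain ⟨d1, d2, d3, d4⟩ := mul_mem_le hP1 hQ1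
  obtain ⟨g1, g2, g3, g4⟩ := mul_mem_le hP2 hQ2
  obtain ⟨u1, u1'⟩ := hP1
  obtain ⟨u2, u2'⟩ := hP2
  obtain ⟨u3, u3'⟩ := hP3
  obtain ⟨v1, v1'⟩ := hQ1
  obtain ⟨v2, v2'⟩ := hQ2
  -- Each bound compares the total room 2(1 + k) with two same-side gaps that together nearly fill
  -- it.
  have hy : p₂ - q₂ ≤ k * (2 - P₃ - P₂ * P₃ - Q₁ - Q₁ * Q₂) := by linarith
  have hx1 : p₁ - q₁ ≤ k * (2 - P₁ * P₂ - P₃ - P₂ * P₃ - Q₁) := by linarith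
  have hx2 : q₁ - p₁ ≤ k * (2 - Q₁ * Q₂ - P₃ - P₂ * P₃ - P₁) := by linarith
  have key := defects_eq_zero (a := 1 - P₂) (b := 1 - Q₂) (c := 1 - P₁) (d := 1 - Q₁)
    (x := p₂ - q₂) (y := p₁ - q₁) (M := 9 / 10) (by linarith) (by linarith)
    (by linarith) (by linarith) (by linarith) (by linarith) (by linarith) (by linarith)
    (by
      intro δ h1 h2 h3 h4 h0
      -- M = 9/10 is 3k at k = 3/10: each bracket is at most the sum of three defects.
      have hk : k * (3 * δ) ≤ 9 / 10 * δ := by nlinarith only [k1, h0]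
      rw [abs_le, abs_le]
      have m1 : k * (2 - P₃ - P₂ * P₃ - Q₁ - Q₁ * Q₂) ≤ k * (3 * δ) :=
        mul_le_mul_of_nonneg_left (by linarith) k0
      have m2 : k * (2 - P₁ * P₂ - P₃ - P₂ * P₃ - Q₁) ≤ k * (3 * δ) :=
        mul_le_mul_of_nonneg_left (by linarith) k0
      have m3 : k * (2 - Q₁ * Q₂ - P₃ - P₂ * P₃ - P₁) ≤ k * (3 * δ) :=
        mul_le_mul_of_nonneg_left (by linarith) k0
      refine ⟨⟨by linarith, by linarith⟩, by linarith, by linarith⟩)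
    (by linarith) (by linarith) (by linarith) (by linarith)
  obtain ⟨h1, h2, h3, h4⟩ := key
  obtain rfl : P₂ = 1 := by linarith
  obtain rfl : Q₂ = 1 := by linarith
  obtain rfl : P₁ = 1 := by linarith
  obtain rfl : Q₁ = 1 := by linarith
  -- With the four heights equal to 1, `hy` reads p₂ - q₂ ≤ -2 k P₃, against q₂ ≤ p₂.
  have hP3 : P₃ = 0 :=
    le_antisymm (le_of_not_gt fun hc => absurd (mul_pos kp hc) (by linarith)) u3
  subst hP3
  exact ⟨rfl, rfl, rfl, rfl, rfl, by linarith, by linarith, by linarith, by linarith, by linarith⟩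

/-- Both lower points are outside the interval spanned by the upper ones. -/
theorem StripPacking.cubic_of_outside {k P₁ P₂ P₃ Q₁ Q₂ p₁ p₂ p₃ q₁ q₂ : ℝ}
    (h : StripPacking k P₁ P₂ P₃ Q₁ Q₂ p₁ p₂ p₃ q₁ q₂) (hq₁ : q₁ ≤ p₁) (hq₂ : p₃ ≤ q₂) :
    StripCubic P₁ P₂ P₃ Q₁ Q₂ p₁ p₂ p₃ q₁ q₂ := by
  obtain ⟨kp, k1, hP1, hP2, hP3, hQ1, hQ2, e1, e2, e3, e4, e5, e6, e7, f1, f2, f3, f4, f5, f6⟩ := h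
  have k0 := kp.le
  obtain ⟨a1, a2, a3, a4⟩ := mul_mem_le hP1 hP2
  obtain ⟨b1, b2, b3, b4⟩ := mul_mem_le hP2 hP3
  obtain ⟨d1, d2, d3, d4⟩ := mul_mem_le hP1 hQ1
  obtain ⟨g1, g2, g3, g4⟩ := mul_mem_le hP3 hQ2
  obtain ⟨u1, u1'⟩ := hP1
  obtain ⟨u2, u2'⟩ := hP2
  obtain ⟨u3, u3'⟩ := hP3
  obtain ⟨v1, v1'⟩ := hQ1
  obtain ⟨v2, v2'⟩ := hQ2
  have hxy : (p₁ - q₁) + (q₂ - p₃) ≤ k * (2 - Q₁ - Q₂ - P₁ * P₂ - P₂ * P₃) := by linarith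
  have key := defects_eq_zero (a := 1 - P₁) (b := 1 - Q₁) (c := 1 - P₃) (d := 1 - Q₂)
    (x := p₁ - q₁) (y := p₃ - q₂) (M := 9 / 10) (by linarith) (by linarith)
    (by linarith) (by linarith) (by linarith) (by linarith) (by linarith) (by linarith)
    (by
      intro δ h1 h2 h3 h4 h0
      have hk : k * (3 * δ) ≤ 9 / 10 * δ := by nlinarith only [k1, h0]
      rw [abs_le, abs_le]
      have m1 : k * (2 - Q₁ - Q₂ - P₁ * P₂ - P₂ * P₃) ≤ k * (3 * δ) :=
        mul_le_mul_of_nonneg_left (by linarith) k0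
      refine ⟨⟨by linarith, by linarith⟩, by linarith, by linarith⟩)
    (by linarith) (by linarith) (by linarith) (by linarith)
  obtain ⟨h1, h2, h3, h4⟩ := key
  obtain rfl : P₁ = 1 := by linarith
  obtain rfl : Q₁ = 1 := by linarith
  obtain rfl : P₃ = 1 := by linarith
  obtain rfl : Q₂ = 1 := by linarith
  have hP2 : P₂ = 0 :=
    le_antisymm (le_of_not_gt fun hc => absurd (mul_pos kp hc) (by linarith)) u2
  subst hP2
  exact ⟨rfl, rfl, rfl, rfl, rfl, by linarith, by linarith, by linarith, by linarith, by linarith⟩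

/-- With r = 1 - a - b, the bounds on z² and w² give z w ≥ r, hence (z + w)² ≥ 1 + 3r, whereas the
available room only allows z + w ≤ 1 + (3/10) r. So r = 0 and every estimate is tight. -/
theorem sqrt_sum_rigidity {k a b z w x : ℝ} (kp : 0 < k) (k1 : k ≤ 3 / 10)
    (a0 : 0 ≤ a) (b0 : 0 ≤ b) (b1 : b ≤ 1) (z0 : 0 ≤ z) (w0 : 0 ≤ w) (x0 : 0 ≤ x)
    (hz : 1 - a ≤ z ^ 2) (hw : 1 - b ≤ w ^ 2) (hlow : 1 + k * (a * b) ≤ z + w)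
    (hg : z + w ≤ 1 + k * (1 - a - b) - 64 / 100 * x) :
    x = 0 ∧ a + b = 1 ∧ a * b = 0 ∧ z + w = 1 := by
  have hab : 0 ≤ a * b := mul_nonneg a0 b0
  have hkab : 0 ≤ k * (a * b) := mul_nonneg kp.le hab
  obtain ⟨r, hr⟩ : ∃ r, r = 1 - a - b := ⟨_, rfl⟩
  rw [← hr] at hg
  have hs : 0 ≤ r := by
    by_contra hneg
    have : k * r < 0 := mul_neg_of_pos_of_neg kp (by linarith)
    linarith
  have hzw : r ≤ z * w := by
    have h1 : r ^ 2 ≤ (z * w) ^ 2 := by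
      rw [mul_pow]
      calc r ^ 2 ≤ (1 - a) * (1 - b) := by rw [hr]; nlinarith only [hs, hr, a0, b0, hab]
        _ ≤ z ^ 2 * w ^ 2 := mul_le_mul hz hw (by linarith) (by positivity)
    exact le_of_sq_le_sq h1 (by positivity)
  have hsq : 1 + 3 * r ≤ (z + w) ^ 2 := by nlinarith only [hz, hw, hzw, hr]
  have h1 : z + w ≤ 1 + 3 / 10 * r := by nlinarith only [hg, hs, k1, x0]
  have h2 : (z + w) ^ 2 ≤ (1 + 3 / 10 * r) ^ 2 := pow_le_pow_left₀ (by linarith) h1 2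
  have hr0 : r = 0 := by
    have hr1 : r ≤ 1 := by linarith
    nlinarith only [h2, hsq, hr1, hs]
  rw [hr0] at hg
  have hkab0 : k * (a * b) = 0 := by linarith
  refine ⟨by linarith, by linarith, ?_, by linarith⟩
  rcases mul_eq_zero.1 hkab0 with h | h
  · exact absurd h kp.ne'
  · exact h

/-- The first lower point precedes all upper ones, the second one lies between the last two. -/
theorem StripPacking.of_le_of_between {k P₁ P₂ P₃ Q₁ Q₂ p₁ p₂ p₃ q₁ q₂ : ℝ}
    (h : StripPacking k P₁ P₂ P₃ Q₁ Q₂ p₁ p₂ p₃ q₁ q₂)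
    (hq₁ : q₁ ≤ p₁) (hq₂ : p₂ ≤ q₂) (hq₂' : q₂ ≤ p₃) :
    StripCubic P₁ P₂ P₃ Q₁ Q₂ p₁ p₂ p₃ q₁ q₂ ∨
      StripHexagonal k P₁ P₂ P₃ Q₁ Q₂ p₁ p₂ p₃ q₁ q₂ := by
  obtain ⟨kp, k1, hP1, hP2, hP3, hQ1, hQ2, e1, e2, e3, e4, e5, e6, e7, f1, f2, f3, f4, f5, f6⟩ := h
  have k0 := kp.le
  obtain ⟨a1, a2, a3, a4⟩ := mul_mem_le hP1 hP2
  obtain ⟨b1, b2, b3, b4⟩ := mul_mem_le hP2 hP3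
  obtain ⟨d1, d2, d3, d4⟩ := mul_mem_le hP1 hQ1
  obtain ⟨g1, g2, g3, g4⟩ := mul_mem_le hP3 hQ2
  obtain ⟨i1, i2, i3, i4⟩ := mul_mem_le hP2 hQ2
  obtain ⟨u1, u1'⟩ := hP1
  obtain ⟨u2, u2'⟩ := hP2
  obtain ⟨u3, u3'⟩ := hP3
  obtain ⟨v1, v1'⟩ := hQ1
  obtain ⟨v2, v2'⟩ := hQ2
  obtain ⟨x, hx⟩ : ∃ x, x = p₁ - q₁ := ⟨_, rfl⟩
  obtain ⟨z, hz⟩ : ∃ z, z = q₂ - p₂ := ⟨_, rfl⟩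
  obtain ⟨w, hw⟩ : ∃ w, w = p₃ - q₂ := ⟨_, rfl⟩
  have x0 : 0 ≤ x := by linarith
  have z0 : 0 ≤ z := by linarith
  have w0 : 0 ≤ w := by linarith
  have hx1 : x ≤ 6 / 10 := by
    have : k * (2 - Q₁ - P₁ * P₂ - P₃ - P₂ * P₃) ≤ k * 2 :=
      mul_le_mul_of_nonneg_left (by linarith) k0
    linarith
  have fx : 1 - P₁ * Q₁ ≤ x ^ 2 := by rw [hx]; exact f1
  have fz : 1 - P₂ * Q₂ ≤ z ^ 2 := by rw [hz]; linarith
  have fw : 1 - P₃ * Q₂ ≤ w ^ 2 := by rw [hw]; linarith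
  have fx' : x ^ 2 ≤ 6 / 10 * x := by nlinarith only [x0, hx1]
  -- The defects of P₁ and Q₁ are at most x² ≤ (6/10) x, so each costs at most (3/10)(6/10) x =
  -- (18/100) x. The two of them leave 1 - 2 · 18/100 = 64/100 of x for `sqrt_sum_rigidity`.
  have hP2x : k * (P₂ - P₁ * P₂) ≤ 18 / 100 * x := by
    have h0 : P₂ - P₁ * P₂ ≤ 1 - P₁ := by nlinarith only [u2, u2', u1, u1']
    have : k * (P₂ - P₁ * P₂) ≤ 3 / 10 * (6 / 10 * x) :=
      mul_le_mul k1 (by linarith) (by linarith) (by norm_num)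
    linarith
  have hQ1x : k * (1 - Q₁) ≤ 18 / 100 * x := by
    have : k * (1 - Q₁) ≤ 3 / 10 * (6 / 10 * x) :=
      mul_le_mul k1 (by linarith) (by linarith) (by norm_num)
    linarith
  obtain ⟨hx0, hr, hab, hzw⟩ := sqrt_sum_rigidity kp k1 u2 u3 u3' z0 w0 x0
    (by linarith) (by linarith) (by linarith) (by linarith)
  have fx0 : x ^ 2 = 0 := by rw [hx0]; norm_num
  obtain rfl : P₁ = 1 := by linarith
  obtain rfl : Q₁ = 1 := by linarith
  rcases mul_eq_zero.1 hab with h0 | h0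
  · left
    subst h0
    obtain rfl : P₃ = 1 := by linarith
    have hz1 : z = 1 := by nlinarith only [hzw, fz, w0, z0]
    have hw1 : w = 0 := by linarith
    rw [hw1] at fw
    obtain rfl : Q₂ = 1 := by linarith
    exact ⟨rfl, rfl, rfl, rfl, rfl, by linarith, by linarith, by linarith, by linarith, by linarith⟩
  · right
    subst h0
    obtain rfl : P₂ = 1 := by linarith
    have hw1 : w = 1 := by nlinarith only [hzw, fw, w0, z0]
    have hz1 : z = 0 := by linarith
    rw [hz1] at fz
    obtain rfl : Q₂ = 1 := by linarith
    exact ⟨rfl, rfl, rfl, rfl, rfl, by linarith, by linarith, by linarith, by linarith, by linarith⟩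

/-- For alternating points, the square roots `α`, `γ` of the defects of the outer points cannot be
small without vanishing. -/
theorem sum_eq_zero_or_large {k α γ β : ℝ} (k1 : k ≤ 3 / 10)
    (α0 : 0 ≤ α) (γ0 : 0 ≤ γ) (β0 : 0 ≤ β)
    (hI : α + γ + 2 * β ≤ 2 + k * (α ^ 2 + γ ^ 2))
    (hIII : (2 - (α ^ 2 + γ ^ 2)) * (2 - β ^ 2) ≤ 2) :
    (α = 0 ∧ γ = 0) ∨ 8 / 10 < α + γ := by
  by_contra! hcon
  obtain ⟨hne, ht⟩ := hcon
  obtain ⟨t, htd⟩ : ∃ t, t = α + γ := ⟨_, rfl⟩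
  have ht0 : 0 < t := by
    rcases α0.lt_or_eq with h | h
    · linarith
    · rcases γ0.lt_or_eq with h' | h'
      · linarith
      · exact absurd h'.symm (hne h.symm)
  have hσ : α ^ 2 + γ ^ 2 ≤ t ^ 2 := by rw [htd]; nlinarith only [mul_nonneg α0 γ0]
  rw [← htd] at ht hI
  have hβ : β ≤ 1 - (t / 2 - 15 / 100 * t ^ 2) := by
    have : k * (α ^ 2 + γ ^ 2) ≤ 3 / 10 * t ^ 2 := mul_le_mul k1 hσ (by positivity) (by norm_num)
    linarith
  obtain ⟨e, he⟩ : ∃ e, e = t / 2 - 15 / 100 * t ^ 2 := ⟨_, rfl⟩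
  rw [← he] at hβ
  -- As t grows from 0, `hI` lowers β to first order in t while α² + γ² is only of second order,
  -- which `hIII` does not tolerate. The constants are 38/100 = 1/2 - (15/100)(8/10) and 608/1000 =
  -- (38/100)(2 - 4/10).
  have he1 : 38 / 100 * t ≤ e := by rw [he]; nlinarith only [ht0, ht]
  have he2 : e ≤ 4 / 10 := by rw [he]; nlinarith only [ht0, ht]
  have hβ2 : β ^ 2 ≤ (1 - e) ^ 2 := pow_le_pow_left₀ β0 hβ 2
  have h2 : 1 + 608 / 1000 * t ≤ 2 - β ^ 2 := by nlinarith only [he1, he2, hβ2, ht0]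
  have h3 : (2 - t ^ 2) * (1 + 608 / 1000 * t) ≤ 2 := by
    refine le_trans (mul_le_mul ?_ h2 (by positivity) ?_) hIII
    · linarith
    · nlinarith only [hσ, ht, ht0]
  have h4 : t * (1216 / 1000 - t - 608 / 1000 * t ^ 2) ≤ 0 := by linarith
  have h5 : 0 < 1216 / 1000 - t - 608 / 1000 * t ^ 2 := by nlinarith only [ht, ht0]
  linarith [mul_pos ht0 h5]

/-- A rough localisation that makes the final contraction applicable. Through `hI`, a large h makes
β small, and `hIII` then forces α² + γ² to be large. If γ > 55/100 this contradicts `hII`; if α <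
6/10 it is too much for α and γ. -/
theorem hexagonal_coarse {k α γ β : ℝ} (k1 : k ≤ 3 / 10)
    (α0 : 0 ≤ α) (α1 : α ≤ 1) (γ0 : 0 ≤ γ) (β0 : 0 ≤ β) (hγα : γ ≤ α)
    (ht : 8 / 10 < α + γ)
    (hI : α + γ + 2 * β ≤ 2 + k * (α ^ 2 + γ ^ 2))
    (hII : α + γ ≤ 1 + k * (α ^ 2 + γ ^ 2))
    (hIII : (2 - (α ^ 2 + γ ^ 2)) * (2 - β ^ 2) ≤ 2) :
    γ ≤ 55 / 100 ∧ 6 / 10 ≤ α := by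
  obtain ⟨h, hh⟩ : ∃ h, h = α + γ - 3 / 10 * (α ^ 2 + γ ^ 2) := ⟨_, rfl⟩
  have hkσ : k * (α ^ 2 + γ ^ 2) ≤ 3 / 10 * (α ^ 2 + γ ^ 2) :=
    mul_le_mul_of_nonneg_right k1 (by positivity)
  have h1 : h ≤ 1 := by linarith
  have hβ : β ≤ 1 - h / 2 := by linarith
  have hβ2 : β ^ 2 ≤ (1 - h / 2) ^ 2 := pow_le_pow_left₀ β0 hβ 2
  have hγ1 : γ ≤ 1 := by linarith
  have hσ : 0 ≤ 2 - (α ^ 2 + γ ^ 2) := by nlinarith only [α0, γ0, hγ1, α1]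
  have key : (2 - (α ^ 2 + γ ^ 2)) * (1 + h - h ^ 2 / 4) ≤ 2 :=
    le_trans (mul_le_mul_of_nonneg_left (by linarith) hσ) hIII
  have hmono : ∀ m, 0 ≤ m → m ≤ h → 1 + m - m ^ 2 / 4 ≤ 1 + h - h ^ 2 / 4 := by
    intro m m0 hm
    nlinarith only [m0, hm, h1]
  have hγ : γ ≤ 55 / 100 := by
    by_contra! hc
    have h2 : 918 / 1000 ≤ h := by rw [hh]; nlinarith only [hc, hγα, α1]
    have h3 := hmono _ (by norm_num) h2
    have h4 : 828 / 1000 ≤ α ^ 2 + γ ^ 2 := by nlinarith only [key, h3, hσ]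
    have h5 : α ^ 2 + γ ^ 2 ≤ (α + γ) ^ 2 - 11 / 10 * (α + γ) + 605 / 1000 := by
      nlinarith only [mul_nonneg (sub_nonneg.2 hc.le) (sub_nonneg.2 (hc.le.trans hγα))]
    have h6 : α + γ ≤ 1 + 3 / 10 * (α ^ 2 + γ ^ 2) := by linarith
    have h7 : 127 / 100 ≤ α + γ := by nlinarith only [h4, h5, ht]
    nlinarith only [h5, h6, h7, α1, hγ1]
  refine ⟨hγ, ?_⟩
  by_contra! hc
  have h1 : α ^ 2 + γ ^ 2 ≤ 6 / 10 * (α + γ) := by nlinarith only [hc, hγα, α0, γ0]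
  have h2 : 656 / 1000 ≤ h := by linarith
  have h3 := hmono _ (by norm_num) h2
  have h4 : 7 / 10 ≤ α ^ 2 + γ ^ 2 := by nlinarith only [key, h3, hσ]
  nlinarith only [h4, hc, hγ, α0, γ0]

/-- Interleaved case: the upper and lower points alternate. -/
theorem StripPacking.of_alternating {k P₁ P₂ P₃ Q₁ Q₂ p₁ p₂ p₃ q₁ q₂ : ℝ}
    (h : StripPacking k P₁ P₂ P₃ Q₁ Q₂ p₁ p₂ p₃ q₁ q₂) (h1 : p₁ ≤ q₁) (h2 : q₁ ≤ p₂)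
    (h3 : p₂ ≤ q₂) (h4 : q₂ ≤ p₃) (hP : P₃ ≤ P₁) :
    StripCubic P₁ P₂ P₃ Q₁ Q₂ p₁ p₂ p₃ q₁ q₂ ∨
      StripHexagonal k P₁ P₂ P₃ Q₁ Q₂ p₁ p₂ p₃ q₁ q₂ := by
  obtain ⟨kp, k1, hP1, hP2, hP3, hQ1, hQ2, e1, e2, e3, e4, e5, e6, e7, f1, f2, f3, f4, f5, f6⟩ := h
  have k0 := kp.le
  obtain ⟨a1, a2, a3, a4⟩ := mul_mem_le hP1 hP2
  obtain ⟨b1, b2, b3, b4⟩ := mul_mem_le hP2 hP3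
  obtain ⟨c1, c2, c3, c4⟩ := mul_mem_le hQ1 hQ2
  obtain ⟨d1, d2, d3, -⟩ := mul_mem_le hP1 hQ1
  obtain ⟨g1, g2, g3, -⟩ := mul_mem_le hP3 hQ2
  obtain ⟨i1, i2, i3, -⟩ := mul_mem_le hP2 hQ2
  obtain ⟨j1, j2, j3, -⟩ := mul_mem_le hP2 hQ1
  obtain ⟨u1, u1'⟩ := hP1
  obtain ⟨u2, u2'⟩ := hP2
  obtain ⟨u3, u3'⟩ := hP3
  obtain ⟨v1, v1'⟩ := hQ1
  obtain ⟨v2, v2'⟩ := hQ2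
  obtain ⟨x, hx⟩ : ∃ x, x = q₁ - p₁ := ⟨_, rfl⟩
  obtain ⟨y, hy⟩ : ∃ y, y = p₂ - q₁ := ⟨_, rfl⟩
  obtain ⟨z, hz⟩ : ∃ z, z = q₂ - p₂ := ⟨_, rfl⟩
  obtain ⟨w, hw⟩ : ∃ w, w = p₃ - q₂ := ⟨_, rfl⟩
  have x0 : 0 ≤ x := by rw [hx]; linarith only [h1]
  have y0 : 0 ≤ y := by rw [hy]; linarith only [h2]
  have z0 : 0 ≤ z := by rw [hz]; linarith only [h3]
  have w0 : 0 ≤ w := by rw [hw]; linarith only [h4]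
  have fx : 1 - P₁ * Q₁ ≤ x ^ 2 := by rw [hx]; linarith only [f1]
  have fy : 1 - P₂ * Q₁ ≤ y ^ 2 := by rw [hy]; exact f2
  have fz : 1 - P₂ * Q₂ ≤ z ^ 2 := by rw [hz]; linarith only [f5]
  have fw : 1 - P₃ * Q₂ ≤ w ^ 2 := by rw [hw]; exact f6
  have hsum : x + y + z + w ≤ 2 + k * ((1 - P₃) + (1 - P₁)) := by linarith only [e1, e4, hx, hy, hz, hw]
  have hxy : 1 + k * (P₁ * P₂) ≤ x + y := by linarith only [e2, hx, hy]
  have hzw : 1 + k * (P₂ * P₃) ≤ z + w := by linarith only [e3, hz, hw]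
  have hyz : 1 + k * (Q₁ * Q₂) ≤ y + z := by linarith only [e6, hy, hz]
  -- The two gaps of the upper row fill the room of `hsum`; the constants cancel and k divides out.
  have hIII : (P₁ + P₃) * (1 + P₂) ≤ 2 := by
    by_contra! hc
    have := mul_lt_mul_of_pos_left hc kp
    linarith only [this, hsum, hxy, hzw]
  obtain ⟨α, α0, hα⟩ : ∃ α, 0 ≤ α ∧ α ^ 2 = 1 - P₃ :=
    ⟨√(1 - P₃), Real.sqrt_nonneg _, Real.sq_sqrt (by linarith only [u3'])⟩
  obtain ⟨γ, γ0, hγ⟩ : ∃ γ, 0 ≤ γ ∧ γ ^ 2 = 1 - P₁ :=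
    ⟨√(1 - P₁), Real.sqrt_nonneg _, Real.sq_sqrt (by linarith only [u1'])⟩
  obtain ⟨β, β0, hβ⟩ : ∃ β, 0 ≤ β ∧ β ^ 2 = 1 - P₂ :=
    ⟨√(1 - P₂), Real.sqrt_nonneg _, Real.sq_sqrt (by linarith only [u2'])⟩
  have hαw : α ≤ w := le_of_sq_le_sq (by linarith only [hα, fw, g2]) w0
  have hγx : γ ≤ x := le_of_sq_le_sq (by linarith only [hγ, fx, d2]) x0
  have hβy : β ≤ y := le_of_sq_le_sq (by linarith only [hβ, fy, j2]) y0
  have hβz : β ≤ z := le_of_sq_le_sq (by linarith only [hβ, fz, i2]) z0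
  have hγα : γ ≤ α := le_of_sq_le_sq (by linarith only [hα, hγ, hP]) α0
  have hα1 : α ≤ 1 := le_of_sq_le_sq (by linarith only [hα, u3]) zero_le_one
  rw [← hα, ← hγ] at hsum
  have hI : α + γ + 2 * β ≤ 2 + k * (α ^ 2 + γ ^ 2) := by
    linarith only [hsum, hαw, hγx, hβy, hβz]
  have hIII' : (2 - (α ^ 2 + γ ^ 2)) * (2 - β ^ 2) ≤ 2 := by
    rw [hα, hβ, hγ]; linarith only [hIII]
  have hkc : 0 ≤ k * (Q₁ * Q₂) := mul_nonneg k0 c1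
  have hka : 0 ≤ k * (P₁ * P₂) := mul_nonneg k0 a1
  rcases sum_eq_zero_or_large k1 α0 γ0 β0 hI hIII' with ⟨hα0, hγ0⟩ | ht
  · left
    rw [hα0] at hα
    rw [hγ0] at hγ
    obtain rfl : P₃ = 1 := by linarith only [hα]
    obtain rfl : P₁ = 1 := by linarith only [hγ]
    obtain rfl : P₂ = 0 := by linarith only [hIII, u2]
    rw [hα0, hγ0] at hsum
    have hy1 : 1 ≤ y := le_of_sq_le_sq (by linarith only [fy]) y0
    have hz1 : 1 ≤ z := le_of_sq_le_sq (by linarith only [fz]) z0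
    have hx0 : x = 0 := by linarith only [hsum, hy1, hz1, x0, w0]
    have hw0 : w = 0 := by linarith only [hsum, hy1, hz1, x0, w0]
    rw [hx0] at fx
    rw [hw0] at fw
    obtain rfl : Q₁ = 1 := by linarith only [fx, v1']
    obtain rfl : Q₂ = 1 := by linarith only [fw, v2']
    exact ⟨rfl, rfl, rfl, rfl, rfl, by linarith, by linarith, by linarith, by linarith, by linarith⟩
  right
  obtain ⟨hγs, hαs⟩ := hexagonal_coarse k1 α0 hα1 γ0 β0 hγα ht hI
    (by linarith only [hsum, hyz, hkc, hαw, hγx]) hIII'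
  have hxle : x ≤ 1 - α + k * (α ^ 2 + γ ^ 2 - Q₁ * Q₂) := by linarith only [hsum, hyz, hαw]
  have hzle : z ≤ 1 - α + k * (α ^ 2 + γ ^ 2 - P₁ * P₂) := by linarith only [hsum, hxy, hαw]
  have hcoarse : 1 - α + k * (α ^ 2 + γ ^ 2) ≤ 6 / 10 := by
    have : k * (α ^ 2 + γ ^ 2) ≤ 3 / 10 * (α ^ 2 + γ ^ 2) :=
      mul_le_mul_of_nonneg_right k1 (by positivity)
    nlinarith only [this, hγs, hαs, γ0, hα1]
  have hx2 : x ^ 2 ≤ 36 / 100 := by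
    have : x ≤ 6 / 10 := by linarith only [hxle, hcoarse, hkc]
    nlinarith only [this, x0]
  have hz2 : z ^ 2 ≤ 36 / 100 := by
    have : z ≤ 6 / 10 := by linarith only [hzle, hcoarse, hka]
    nlinarith only [this, z0]
  have hP3 : P₃ ≤ (1 - P₁) + (1 - P₂) := by nlinarith only [hIII, u2, u2']
  have hα' : 16 / 10 * (1 - α) ≤ P₃ := by nlinarith only [hα, hαs, hα1]
  -- Since 1 - α ≤ (10/16) P₃ and P₃ ≤ 2δ, both x and z are at most 9/10 δ + (10/16 - 3/10) · 2δ =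
  -- 155/100 δ. The defects are at most 36/100, and (155/100)² · 36/100 < 1.
  have key := defects_eq_zero (a := 1 - P₁) (b := 1 - Q₁) (c := 1 - P₂) (d := 1 - Q₂)
    (x := x) (y := z) (M := 155 / 100) (by linarith only [u1']) (by linarith only [v1'])
    (by linarith only [u2']) (by linarith only [v2']) (by linarith only [fx, d2])
    (by linarith only [fx, d3]) (by linarith only [fz, i2]) (by linarith only [fz, i3])
    (by
      intro δ h1 h2 h3 h4 h0
      rw [abs_of_nonneg x0, abs_of_nonneg z0]
      rw [hα, hγ] at hxle hzle
      have m0 : k * (3 * δ - P₃) ≤ 3 / 10 * (3 * δ - P₃) :=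
        mul_le_mul_of_nonneg_right k1 (by linarith only [h1, h3, hP3, h0])
      have m1 : k * (1 - P₃ + (1 - P₁) - Q₁ * Q₂) ≤ k * (3 * δ - P₃) :=
        mul_le_mul_of_nonneg_left (by linarith only [h1, h2, h4, c4]) k0
      have m2 : k * (1 - P₃ + (1 - P₁) - P₁ * P₂) ≤ k * (3 * δ - P₃) :=
        mul_le_mul_of_nonneg_left (by linarith only [h1, h3, a4]) k0
      exact ⟨by linarith only [hxle, m0, m1, hα', hP3, h1, h3],
        by linarith only [hzle, m0, m2, hα', hP3, h1, h3]⟩)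
    (by linarith only [fx, d2, hx2]) (by linarith only [fx, d3, hx2])
    (by linarith only [fz, i2, hz2]) (by linarith only [fz, i3, hz2])
  obtain ⟨r1, r2, r3, r4⟩ := key
  obtain rfl : P₁ = 1 := by linarith only [r1]
  obtain rfl : Q₁ = 1 := by linarith only [r2]
  obtain rfl : P₂ = 1 := by linarith only [r3]
  obtain rfl : Q₂ = 1 := by linarith only [r4]
  obtain rfl : P₃ = 0 := by linarith only [hIII, u3]
  rw [hα, hγ] at hsum
  have hw1 : 1 ≤ w := le_of_sq_le_sq (by linarith only [fw]) w0
  have hx0 : x = 0 := by linarith only [hsum, hyz, hw1, x0]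
  have hz0 : z = 0 := by linarith only [hsum, hxy, hw1, z0]
  exact ⟨rfl, rfl, rfl, rfl, rfl, by linarith, by linarith, by linarith, by linarith, by linarith⟩

/-- A packing of the strip is cubic or, up to reflection, hexagonal. -/
theorem StripPacking.classification {k P₁ P₂ P₃ Q₁ Q₂ p₁ p₂ p₃ q₁ q₂ : ℝ}
    (h : StripPacking k P₁ P₂ P₃ Q₁ Q₂ p₁ p₂ p₃ q₁ q₂) :
    StripCubic P₁ P₂ P₃ Q₁ Q₂ p₁ p₂ p₃ q₁ q₂ ∨
      StripHexagonal k P₁ P₂ P₃ Q₁ Q₂ p₁ p₂ p₃ q₁ q₂ ∨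
        StripHexagonal k P₃ P₂ P₁ Q₂ Q₁ (-p₃) (-p₂) (-p₁) (-q₂) (-q₁) := by
  rcases le_total q₂ p₂ with h1 | h1
  · exact .inr (.inl (h.hexagonal_of_le h1))
  rcases le_total p₂ q₁ with h2 | h2
  · exact .inr (.inr (h.mirror.hexagonal_of_le (by linarith)))
  -- Now p₂ lies between q₁ and q₂, and only the positions relative to p₁ and p₃ are open.
  rcases le_total q₁ p₁ with h3 | h3 <;> rcases le_total p₃ q₂ with h4 | h4
  · exact .inl (h.cubic_of_outside h3 h4)
  · rcases h.of_le_of_between h3 h1 h4 with h | h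
    · exact .inl h
    · exact .inr (.inl h)
  · rcases h.mirror.of_le_of_between (by linarith) (by linarith) (by linarith) with h | h
    · exact .inl h.of_mirror
    · exact .inr (.inr h)
  · rcases le_total P₃ P₁ with h5 | h5
    · rcases h.of_alternating h3 h2 h1 h4 h5 with h | h
      · exact .inl h
      · exact .inr (.inl h)
    · rcases h.mirror.of_alternating (by linarith) (by linarith) (by linarith) (by linarith) h5
        with h | h
      · exact .inl h.of_mirror
      · exact .inr (.inr h)

/-! ### The unit of longitude and the excess -/

/-- The angle between the axis and a vertex of the cube: half of `π - arccos (1 / 3)`. -/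
noncomputable def magic : ℝ := Real.arctan √2

/-- The excess ratio `(arccos (1 / 3) - magic) / magic`. -/
noncomputable def excess : ℝ := Real.pi / magic - 3

theorem cos_magic : Real.cos magic = 1 / √3 := by
  rw [magic, Real.cos_arctan, Real.sq_sqrt (by norm_num)]
  norm_num

theorem sin_magic : Real.sin magic = √2 / √3 := by
  rw [magic, Real.sin_arctan, Real.sq_sqrt (by norm_num)]
  norm_num

theorem tan_magic : Real.tan magic = √2 := Real.tan_arctan _

theorem pi_div_four_lt_magic : Real.pi / 4 < magic := by
  rw [← Real.arctan_one, magic]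
  exact Real.arctan_strictMono (Real.lt_sqrt_of_sq_lt (by norm_num))

theorem magic_lt_pi_div_three : magic < Real.pi / 3 := by
  rw [← Real.arctan_tan (x := Real.pi / 3) (by linarith [Real.pi_pos]) (by linarith [Real.pi_pos]),
    Real.tan_pi_div_three, magic]
  exact Real.arctan_strictMono (Real.sqrt_lt_sqrt (by norm_num) (by norm_num))

theorem magic_pos : 0 < magic := by linarith [pi_div_four_lt_magic, Real.pi_pos]

theorem excess_mul_magic : excess * magic = Real.pi - 3 * magic := by
  rw [excess, sub_mul, div_mul_cancel₀ _ magic_pos.ne']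

theorem excess_pos : 0 < excess := by
  have h : 0 < excess * magic := by rw [excess_mul_magic]; linarith [magic_lt_pi_div_three]
  exact pos_of_mul_pos_left h magic_pos.le

theorem cos_three_magic : Real.cos (3 * magic) = -(5 / (3 * √3)) := by
  have h3 : √3 ^ 2 = 3 := Real.sq_sqrt (by norm_num)
  have h0 : √3 ≠ 0 := by positivity
  rw [Real.cos_three_mul, cos_magic]
  field_simp
  nlinarith

theorem sin_three_magic : Real.sin (3 * magic) = √2 / (3 * √3) := by
  have h3 : √3 ^ 2 = 3 := Real.sq_sqrt (by norm_num)
  have h2 : √2 ^ 2 = 2 := Real.sq_sqrt (by norm_num)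
  have h0 : √3 ≠ 0 := by positivity
  rw [Real.sin_three_mul, sin_magic]
  field_simp
  rw [h2, h3]
  ring

/-- The angle π - 3 `magic` is less than its tangent √2/5, which also bounds `magic` from below. -/
theorem excess_le : excess ≤ 3 / 10 := by
  have h0 : √3 ≠ 0 := by positivity
  have hpos : 0 < Real.pi - 3 * magic := by linarith [magic_lt_pi_div_three]
  have hlt := Real.lt_tan hpos (by linarith [pi_div_four_lt_magic, Real.pi_pos])
  have htan : Real.tan (Real.pi - 3 * magic) = √2 / 5 := by
    rw [Real.tan_eq_sin_div_cos, Real.sin_pi_sub, Real.cos_pi_sub, cos_three_magic, sin_three_magic]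
    field_simp
  have hs : √2 < 1415 / 1000 := (Real.sqrt_lt' (by norm_num)).2 (by norm_num)
  have hmagic : 94 / 100 + 4 / 1000 ≤ magic := by
    linarith [Real.pi_gt_d2]
  have : excess * magic ≤ 3 / 10 * magic := by
    rw [excess_mul_magic]; linarith
  exact le_of_mul_le_mul_right this magic_pos

/-! ### The minimal gap of longitudes and its concavity -/

/-- The smallest possible difference of longitudes of two points at distance at least `π / 3`, if
one quadruples the product of their heights to get `σ` and lets one height be `1 / 2`. -/
noncomputable def minGap (σ : ℝ) : ℝ := Real.arctan (2 * √((1 + σ) / (2 - σ)))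

theorem cos_minGap {σ : ℝ} (h1 : -1 ≤ σ) (h2 : σ ≤ 1) :
    Real.cos (minGap σ) = √((2 - σ) / (6 + 3 * σ)) := by
  have hpos : 0 < 2 - σ := by linarith
  rw [minGap, Real.cos_arctan, mul_pow, Real.sq_sqrt (div_nonneg (by linarith) hpos.le),
    ← Real.sqrt_one, ← Real.sqrt_div (by norm_num)]
  congr 1
  have h3 : 0 < 6 + 3 * σ := by linarith
  have : 1 + 2 ^ 2 * ((1 + σ) / (2 - σ)) = (6 + 3 * σ) / (2 - σ) := by
    field_simp
    ring
  rw [Real.sqrt_one, this, one_div_div]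

theorem minGap_zero : minGap 0 = magic := by
  rw [minGap, magic]
  congr 1
  rw [show (2 : ℝ) * √((1 + 0) / (2 - 0)) = √(2 ^ 2) * √((1 + 0) / (2 - 0)) by
    rw [Real.sqrt_sq (by norm_num)], ← Real.sqrt_mul (by norm_num)]
  norm_num

theorem minGap_one : minGap 1 = Real.pi - 2 * magic := by
  have h := pi_div_four_lt_magic
  have h' := magic_lt_pi_div_three
  rw [← Real.arctan_tan (x := Real.pi - 2 * magic) (by linarith) (by linarith), minGap,
    Real.tan_pi_sub, Real.tan_two_mul, tan_magic, Real.sq_sqrt (by norm_num)]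
  norm_num [div_neg, Real.arctan_neg]

theorem minGap_nonneg (σ : ℝ) : 0 ≤ minGap σ := Real.arctan_nonneg.2 (by positivity)

theorem minGap_le_abs {w w' d : ℝ} (hw : |w| ≤ 1 / 2) (hw' : |w'| ≤ 1 / 2)
    (h : w * w' + √(1 - w ^ 2) * √(1 - w' ^ 2) * Real.cos d ≤ 1 / 2) :
    minGap (4 * (w * w')) ≤ |d| := by
  obtain ⟨hw1, hw2⟩ := abs_le.1 hw
  obtain ⟨hw1', hw2'⟩ := abs_le.1 hw'
  obtain ⟨σ, hσ⟩ : ∃ σ, σ = 4 * (w * w') := ⟨_, rfl⟩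
  have hσ2 : σ ≤ 1 := by rw [hσ]; nlinarith
  have hσ1 : -1 ≤ σ := by rw [hσ]; nlinarith
  rw [← hσ]
  by_contra! hlt
  have hlt_pi : minGap σ < Real.pi / 2 := Real.arctan_lt_pi_div_two _
  have hc : Real.cos (minGap σ) < Real.cos d := by
    rw [← Real.cos_abs d]
    exact Real.cos_lt_cos_of_nonneg_of_le_pi (abs_nonneg d)
      (hlt_pi.le.trans (by linarith [Real.pi_pos])) hlt
  rw [cos_minGap hσ1 hσ2] at hc
  -- For a given product w w', the sum w² + w'² is largest when one of the heights is ±1/2; this is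
  -- (1 - 4w²)(1 - 4w'²) ≥ 0.
  have hprod : √(3 / 4 * (1 - σ ^ 2 / 4)) ≤ √(1 - w ^ 2) * √(1 - w' ^ 2) := by
    rw [← Real.sqrt_mul (by nlinarith)]
    apply Real.sqrt_le_sqrt
    rw [hσ]
    nlinarith [mul_nonneg (show 0 ≤ 1 - 4 * w ^ 2 by nlinarith) (show 0 ≤ 1 - 4 * w' ^ 2 by nlinarith)]
  have hval : √(3 / 4 * (1 - σ ^ 2 / 4)) * √((2 - σ) / (6 + 3 * σ)) = 1 / 2 - σ / 4 := by
    rw [← Real.sqrt_mul (by nlinarith), show 3 / 4 * (1 - σ ^ 2 / 4) * ((2 - σ) / (6 + 3 * σ))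
      = (1 / 2 - σ / 4) ^ 2 by
        have : 6 + 3 * σ ≠ 0 := by linarith
        field_simp
        ring]
    exact Real.sqrt_sq (by linarith)
  have hpos : 0 < √(3 / 4 * (1 - σ ^ 2 / 4)) := Real.sqrt_pos.2 (by nlinarith)
  have h0 : 0 ≤ √((2 - σ) / (6 + 3 * σ)) := Real.sqrt_nonneg _
  have h1 : √(3 / 4 * (1 - σ ^ 2 / 4)) * √((2 - σ) / (6 + 3 * σ)) <
      √(1 - w ^ 2) * √(1 - w' ^ 2) * Real.cos d :=
    mul_lt_mul' hprod hc h0 (hpos.trans_le hprod)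
  linarith

theorem concaveOn_minGap : ConcaveOn ℝ (Set.Icc 0 1) minGap := by
  have hder : ∀ m ∈ Set.Icc (0 : ℝ) 1,
      HasDerivAt minGap (1 / √((1 + m) * (2 - m) * (2 + m) ^ 2)) m := by
    rintro m ⟨m0, m1⟩
    have h2 : 0 < 2 - m := by linarith
    have hr : 0 < (1 + m) / (2 - m) := by positivity
    have hd : HasDerivAt (fun m : ℝ => (1 + m) / (2 - m)) (3 / (2 - m) ^ 2) m := by
      have := ((hasDerivAt_id m).const_add 1).div ((hasDerivAt_id m).const_sub 2) h2.ne'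
      refine this.congr_deriv ?_
      simp only [id]
      ring
    refine ((hd.sqrt hr.ne').const_mul 2).arctan.congr_deriv ?_
    have hs : √((1 + m) * (2 - m) * (2 + m) ^ 2) = √((1 + m) / (2 - m)) * ((2 - m) * (2 + m)) := by
      rw [← Real.sqrt_sq (show 0 ≤ (2 - m) * (2 + m) by positivity), ← Real.sqrt_mul hr.le]
      congr 1
      field_simp
    have hq := Real.sq_sqrt hr.le
    have hs0 := Real.sqrt_pos.2 hr
    rw [hs, mul_pow, hq]
    generalize √((1 + m) / (2 - m)) = r at *
    have h3 : 1 + 2 ^ 2 * ((1 + m) / (2 - m)) = 3 * (2 + m) / (2 - m) := by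
      field_simp
      ring
    rw [h3]
    have : 0 < 2 + m := by linarith
    field_simp
  apply AntitoneOn.concaveOn_of_deriv (convex_Icc 0 1)
  · exact fun m hm => (hder m hm).continuousAt.continuousWithinAt
  · intro m hm
    exact (hder m (interior_subset hm)).differentiableAt.differentiableWithinAt
  · intro m hm n hn hmn
    rw [(hder m (interior_subset hm)).deriv, (hder n (interior_subset hn)).deriv]
    obtain ⟨m0, m1⟩ := interior_subset hm
    obtain ⟨n0, n1⟩ := interior_subset hn
    have : 0 < 2 - m := by linarith
    apply one_div_le_one_div_of_le (Real.sqrt_pos.2 (by positivity))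
    apply Real.sqrt_le_sqrt
    have h1 : 0 ≤ (n - m) := by linarith
    have key : (1 + n) * (2 - n) * (2 + n) ^ 2 - (1 + m) * (2 - m) * (2 + m) ^ 2 =
        (n - m) * (12 + 2 * (n + m) - 3 * (n ^ 2 + n * m + m ^ 2)
          - (n ^ 3 + n ^ 2 * m + n * m ^ 2 + m ^ 3)) := by ring
    have h2 : n ^ 2 ≤ n := by nlinarith
    have h3 : m ^ 2 ≤ m := by nlinarith
    have h4 : n ^ 3 ≤ n := by nlinarith
    have h5 : m ^ 3 ≤ m := by nlinarith
    have h6 : n ^ 2 * m ≤ n := by nlinarith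
    have h7 : n * m ^ 2 ≤ m := by nlinarith
    have h8 : n * m ≤ 1 := by nlinarith
    have h9 := mul_nonneg h1 (show 0 ≤ 12 + 2 * (n + m) - 3 * (n ^ 2 + n * m + m ^ 2)
      - (n ^ 3 + n ^ 2 * m + n * m ^ 2 + m ^ 3) by linarith)
    linarith

/-- A concave function lies above its chord, here from `magic` at 0 to π - 2 `magic` = (1 +
`excess`) `magic` at 1. -/
theorem le_minGap_of_nonneg {m : ℝ} (m0 : 0 ≤ m) (m1 : m ≤ 1) :
    magic * (1 + excess * m) ≤ minGap m := by
  have h := concaveOn_minGap.2 (Set.left_mem_Icc.2 zero_le_one) (Set.right_mem_Icc.2 zero_le_one)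
    (sub_nonneg.2 m1) m0 (by ring)
  simp only [smul_eq_mul, mul_zero, zero_add, mul_one, minGap_zero, minGap_one] at h
  linarith [congrArg (· * m) excess_mul_magic]

/-- The substitution σ = x² - 1 removes the square-root singularity of `minGap` at σ = -1, so that a
linear bound in x becomes the bound √(1 - m) in `le_minGap_of_nonpos`. -/
theorem concaveOn_minGap_sq : ConcaveOn ℝ (Set.Icc 0 1) fun x => minGap (x ^ 2 - 1) := by
  have heq : ∀ x : ℝ, 0 ≤ x → minGap (x ^ 2 - 1) = Real.arctan (2 * x / √(3 - x ^ 2)) := by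
    intro x x0
    rw [minGap, show 1 + (x ^ 2 - 1) = x ^ 2 by ring, show 2 - (x ^ 2 - 1) = 3 - x ^ 2 by ring,
      Real.sqrt_div (sq_nonneg x), Real.sqrt_sq x0, mul_div_assoc]
  refine ConcaveOn.congr (f := fun x => Real.arctan (2 * x / √(3 - x ^ 2))) ?_
    fun x hx => (heq x hx.1).symm
  have hder : ∀ x ∈ Set.Icc (0 : ℝ) 1, HasDerivAt (fun x => Real.arctan (2 * x / √(3 - x ^ 2)))
      (2 / √((1 + x ^ 2) ^ 2 * (3 - x ^ 2))) x := by
    rintro x ⟨x0, x1⟩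
    have h3 : 0 < 3 - x ^ 2 := by nlinarith
    have hs : HasDerivAt (fun x : ℝ => √(3 - x ^ 2)) (-(2 * x) / (2 * √(3 - x ^ 2))) x := by
      have := ((hasDerivAt_pow 2 x).const_sub 3).sqrt h3.ne'
      refine this.congr_deriv ?_
      norm_num
    have hs0 := Real.sqrt_pos.2 h3
    refine ((((hasDerivAt_id x).const_mul 2).div hs hs0.ne').arctan).congr_deriv ?_
    have hq := Real.sq_sqrt h3.le
    rw [Real.sqrt_mul (by positivity), Real.sqrt_sq (by positivity)]
    simp only [id, Pi.div_apply]
    generalize √(3 - x ^ 2) = s at *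
    have h5 : 1 + (2 * x / s) ^ 2 = 3 * (1 + x ^ 2) / s ^ 2 := by
      field_simp
      rw [hq]
      ring
    rw [h5]
    field_simp
    rw [hq]
    ring
  apply AntitoneOn.concaveOn_of_deriv (convex_Icc 0 1)
  · exact fun m hm => (hder m hm).continuousAt.continuousWithinAt
  · intro m hm
    exact (hder m (interior_subset hm)).differentiableAt.differentiableWithinAt
  · intro m hm n hn hmn
    rw [(hder m (interior_subset hm)).deriv, (hder n (interior_subset hn)).deriv]
    obtain ⟨m0, m1⟩ := interior_subset hm
    obtain ⟨n0, n1⟩ := interior_subset hn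
    have hm3 : 0 < 3 - m ^ 2 := by nlinarith
    apply div_le_div_of_nonneg_left (by norm_num) (Real.sqrt_pos.2 (by positivity))
    apply Real.sqrt_le_sqrt
    have h1 : m ^ 2 ≤ n ^ 2 := by gcongr
    have h2 : n ^ 2 ≤ 1 := by nlinarith
    have h0 : 0 ≤ m ^ 2 := sq_nonneg m
    generalize m ^ 2 = a at *
    generalize n ^ 2 = b at *
    have h4 : b ^ 2 ≤ 1 := by nlinarith
    have h5 : a ^ 2 ≤ 1 := by nlinarith
    have h6 : a * b ≤ 1 := by nlinarith
    have h7 := mul_nonneg (sub_nonneg.2 h1)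
      (show 0 ≤ 5 + (a + b) - (a ^ 2 + a * b + b ^ 2) by linarith)
    linarith

theorem le_minGap_of_nonpos {m : ℝ} (m0 : 0 ≤ m) (m1 : m ≤ 1) :
    magic * √(1 - m) ≤ minGap (-m) := by
  have hx0 := Real.sqrt_nonneg (1 - m)
  have hx1 : √(1 - m) ≤ 1 := Real.sqrt_le_one.2 (by linarith)
  have h := concaveOn_minGap_sq.2 (Set.left_mem_Icc.2 zero_le_one)
    (Set.right_mem_Icc.2 zero_le_one) (sub_nonneg.2 hx1) hx0 (by ring)
  simp only [smul_eq_mul, mul_zero, zero_add, mul_one, one_pow, sub_self, minGap_zero,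
    Real.sq_sqrt (sub_nonneg.2 m1)] at h
  rw [show 1 - m - 1 = -m by ring] at h
  have h2 := mul_nonneg (sub_nonneg.2 hx1) (minGap_nonneg (0 ^ 2 - 1))
  linarith

/-! ### Longitude and height of points of the strip -/

theorem E3_inner (x y : E3) : inner ℝ x y = x 0 * y 0 + x 1 * y 1 + x 2 * y 2 := by
  simp [PiLp.inner_apply, Fin.sum_univ_three, mul_comm]

theorem E3_norm_sq (x : E3) : ‖x‖ ^ 2 = x 0 ^ 2 + x 1 ^ 2 + x 2 ^ 2 := by
  rw [← real_inner_self_eq_norm_sq, E3_inner]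
  ring

/-- Longitude with respect to the first coordinate axis, in units of `magic`. -/
noncomputable def lon (x : E3) : ℝ := Complex.arg ⟨x 1, x 2⟩ / magic

theorem magic_mul_lon (x : E3) : magic * lon x = Complex.arg ⟨x 1, x 2⟩ :=
  mul_div_cancel₀ _ magic_pos.ne'

theorem norm_tail {x : E3} (hx : ‖x‖ = 1) : ‖(⟨x 1, x 2⟩ : ℂ)‖ = √(1 - x 0 ^ 2) := by
  have h := E3_norm_sq x
  rw [hx] at h
  rw [Complex.norm_def, Complex.normSq_mk]
  congr 1
  linarith

theorem coord_one {x : E3} (hx : ‖x‖ = 1) :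
    x 1 = √(1 - x 0 ^ 2) * Real.cos (magic * lon x) := by
  rw [magic_mul_lon, ← norm_tail hx, Complex.norm_mul_cos_arg]

theorem coord_two {x : E3} (hx : ‖x‖ = 1) :
    x 2 = √(1 - x 0 ^ 2) * Real.sin (magic * lon x) := by
  rw [magic_mul_lon, ← norm_tail hx, Complex.norm_mul_sin_arg]

/-- A point with prescribed height and longitude. -/
noncomputable def stripPoint (w s : ℝ) : E3 :=
  !₂[w, √(1 - w ^ 2) * Real.cos (magic * s), √(1 - w ^ 2) * Real.sin (magic * s)]

theorem eq_stripPoint {x : E3} (hx : ‖x‖ = 1) : x = stripPoint (x 0) (lon x) := by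
  ext i
  fin_cases i
  · simp [stripPoint]
  · simpa [stripPoint] using coord_one hx
  · simpa [stripPoint] using coord_two hx

/-- The points of the strip of width `π / 3` around the great circle orthogonal to the first axis. -/
def InStrip (x : E3) : Prop := ‖x‖ = 1 ∧ |x 0| ≤ 1 / 2

theorem minGap_le_of_inner {x : E3} {w s : ℝ} (hx : InStrip x) (hw : |w| ≤ 1 / 2)
    (h : inner ℝ x (stripPoint w s) ≤ 1 / 2) :
    minGap (4 * (x 0 * w)) ≤ magic * |lon x - s| := by
  rw [← abs_of_pos magic_pos, ← abs_mul, mul_sub]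
  refine minGap_le_abs hx.2 hw ?_
  rw [Real.cos_sub]
  rw [E3_inner, coord_one hx.1, coord_two hx.1] at h
  simp only [stripPoint, PiLp.toLp_apply, Matrix.cons_val_zero, Matrix.cons_val_one,
    Matrix.cons_val] at h
  linarith

/-- Height of a point of the strip, normalised to the unit interval. -/
noncomputable def height (x : E3) : ℝ := 2 * |x 0|

theorem height_mem {x : E3} (hx : InStrip x) : height x ∈ Set.Icc (0 : ℝ) 1 :=
  ⟨by unfold height; positivity, by unfold height; linarith [hx.2]⟩

theorem height_mul_height (x y : E3) : height x * height y = 4 * |x 0 * y 0| := by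
  rw [height, height, abs_mul]
  ring

theorem lon_gap_of_nonneg {x y : E3} (hx : InStrip x) (hy : InStrip y)
    (h : inner ℝ x y ≤ 1 / 2) (hxy : 0 ≤ x 0 * y 0) :
    1 + excess * (height x * height y) ≤ |lon x - lon y| := by
  rw [eq_stripPoint hy.1] at h
  have h1 := minGap_le_of_inner hx hy.2 h
  have hm := (mul_mem_le (height_mem hx) (height_mem hy))
  rw [height_mul_height, abs_of_nonneg hxy] at *
  have h2 := le_minGap_of_nonneg hm.1 (hm.2.1.trans (height_mem hx).2)
  exact le_of_mul_le_mul_left (h2.trans h1) magic_pos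

theorem lon_gap_of_nonpos {x y : E3} (hx : InStrip x) (hy : InStrip y)
    (h : inner ℝ x y ≤ 1 / 2) (hxy : x 0 * y 0 ≤ 0) :
    1 - height x * height y ≤ (lon x - lon y) ^ 2 := by
  rw [eq_stripPoint hy.1] at h
  have h1 := minGap_le_of_inner hx hy.2 h
  have hm := (mul_mem_le (height_mem hx) (height_mem hy))
  have hm1 := hm.2.1.trans (height_mem hx).2
  have h2 := le_minGap_of_nonpos hm.1 hm1
  rw [height_mul_height, abs_of_nonpos hxy] at *
  rw [show -(4 * -(x 0 * y 0)) = 4 * (x 0 * y 0) by ring] at h2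
  have h3 := le_of_mul_le_mul_left (h2.trans h1) magic_pos
  rw [Real.sqrt_le_left (abs_nonneg _), sq_abs] at h3
  exact h3

/-! ### Constraints imposed by the star -/

/-- The seven vertices of the faces of a star of type `{△, □, △, □}`, with the axis through the two
opposite points `W` and `E` as first coordinate axis. -/
def frameConfig : Set E3 :=
  {!₂[1, 0, 0], !₂[-1, 0, 0], !₂[0, -1, 0],
   !₂[1 / 2, -1 / 2, √2 / 2], !₂[-1 / 2, -1 / 2, √2 / 2],
   !₂[1 / 2, -1 / 2, -√2 / 2], !₂[-1 / 2, -1 / 2, -√2 / 2]}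

theorem sqrt_three_quarters : √(3 / 4) = √3 / 2 := by
  rw [Real.sqrt_div (by norm_num), show (4 : ℝ) = 2 ^ 2 by norm_num, Real.sqrt_sq (by norm_num)]

theorem magic_mul_two_add : magic * (2 + excess) = Real.pi - magic := by
  linarith [excess_mul_magic]

theorem magic_mul_three_add : magic * (3 + excess) = Real.pi := by
  linarith [excess_mul_magic]

theorem stripPoint_of_sq {w : ℝ} (hw : w ^ 2 = 1 / 4) (s : ℝ) :
    stripPoint w s =
      !₂[w, √3 / 2 * Real.cos (magic * s), √3 / 2 * Real.sin (magic * s)] := by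
  rw [stripPoint, hw, ← sqrt_three_quarters]
  norm_num

theorem stripPoint_star {w : ℝ} (hw : w ^ 2 = 1 / 4) :
    stripPoint w (2 + excess) = !₂[w, -1 / 2, √2 / 2] := by
  rw [stripPoint_of_sq hw, magic_mul_two_add, Real.cos_pi_sub, Real.sin_pi_sub, cos_magic,
    sin_magic]
  congr 1
  ext i
  fin_cases i <;> simp
  field_simp

theorem stripPoint_neg (w s : ℝ) : stripPoint w (-s) =
    !₂[stripPoint w s 0, stripPoint w s 1, - stripPoint w s 2] := by
  simp [stripPoint]

theorem stripPoint_star_neg {w : ℝ} (hw : w ^ 2 = 1 / 4) :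
    stripPoint w (-(2 + excess)) = !₂[w, -1 / 2, -√2 / 2] := by
  rw [stripPoint_neg, stripPoint_star hw]
  simp
  ring

theorem stripPoint_pole : stripPoint 0 (3 + excess) = !₂[0, -1, 0] := by
  rw [stripPoint, magic_mul_three_add]
  simp

theorem stripPoint_pole_neg : stripPoint 0 (-(3 + excess)) = !₂[0, -1, 0] := by
  rw [stripPoint_neg, stripPoint_pole]
  simp

theorem inStrip_of_frame {x : E3} (hx : ‖x‖ = 1) (h : ∀ y ∈ frameConfig, inner ℝ x y ≤ 1 / 2) :
    InStrip x := by
  refine ⟨hx, abs_le.2 ⟨?_, ?_⟩⟩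
  · have := h !₂[-1, 0, 0] (by simp [frameConfig])
    rw [E3_inner] at this
    simp at this
    linarith
  · have := h !₂[1, 0, 0] (by simp [frameConfig])
    rw [E3_inner] at this
    simp at this
    linarith

/-- At each of the longitudes ±(2 + k) the frame has points of heights 1/2 and -1/2, so every point
of the strip meets one of them on its own side, at gap at least 1 + k h. The centre of the star, at
±(3 + k), keeps points from lying beyond them. -/
theorem abs_lon_le_of_frame {x : E3} (hx : ‖x‖ = 1)
    (h : ∀ y ∈ frameConfig, inner ℝ x y ≤ 1 / 2) :
    |lon x| ≤ 1 + excess - excess * height x := by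
  have hs := inStrip_of_frame hx h
  have hpi : |lon x| ≤ 3 + excess := by
    refine le_of_mul_le_mul_left ?_ magic_pos
    rw [magic_mul_three_add, ← abs_of_pos magic_pos, ← abs_mul, magic_mul_lon]
    exact Complex.abs_arg_le_pi _
  obtain ⟨hl, hr⟩ := abs_le.1 hpi
  -- The centre of the star lies on the branch cut of `Complex.arg`, so both of its longitudes are
  -- used, and wrap-around needs no separate treatment.
  have hN : ∀ s, stripPoint 0 s = !₂[0, -1, 0] → 1 ≤ |lon x - s| := by
    intro s hs'
    have h1 := minGap_le_of_inner hs (w := 0) (s := s) (by norm_num)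
      (by rw [hs']; exact h _ (by simp [frameConfig]))
    rw [mul_zero, mul_zero, minGap_zero] at h1
    exact le_of_mul_le_mul_left (by linarith) magic_pos
  have hA : ∀ s, (∀ w : ℝ, w ^ 2 = 1 / 4 → stripPoint w s ∈ frameConfig) →
      1 + excess * height x ≤ |lon x - s| := by
    intro s hs'
    have hm := height_mem hs
    have h2 := le_minGap_of_nonneg hm.1 hm.2
    refine le_of_mul_le_mul_left (h2.trans ?_) magic_pos
    rcases abs_cases (x 0) with ⟨he, -⟩ | ⟨he, -⟩
    · have h1 := minGap_le_of_inner hs (w := 1 / 2) (s := s) (by norm_num [abs_of_pos])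
        (h _ (hs' _ (by norm_num)))
      rwa [height, he, show 2 * x 0 = 4 * (x 0 * (1 / 2)) by ring]
    · have h1 := minGap_le_of_inner hs (w := -1 / 2) (s := s)
        (by norm_num [abs_of_neg]) (h _ (hs' _ (by norm_num)))
      rwa [height, he, show 2 * -x 0 = 4 * (x 0 * (-1 / 2)) by ring]
  have hhalf : ∀ w : ℝ, w ^ 2 = 1 / 4 → w = 1 / 2 ∨ w = -1 / 2 := by
    intro w hw
    have : (w - 1 / 2) * (w + 1 / 2) = 0 := by linarith
    rcases mul_eq_zero.1 this with h | h
    · left; linarith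
    · right; linarith
  have n1 := hN _ stripPoint_pole
  have n2 := hN _ stripPoint_pole_neg
  have a1 := hA (2 + excess) (by
    intro w hw
    rw [stripPoint_star hw]
    rcases hhalf w hw with rfl | rfl <;> simp [frameConfig])
  have a2 := hA (-(2 + excess)) (by
    intro w hw
    rw [stripPoint_star_neg hw]
    rcases hhalf w hw with rfl | rfl <;> simp [frameConfig])
  have hk := mul_nonneg excess_pos.le (height_mem hs).1
  rw [abs_of_nonpos (by linarith)] at n1
  rw [abs_of_nonneg (by linarith)] at n2
  rw [abs_of_nonpos (by linarith)] at a1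
  rw [abs_of_nonneg (by linarith)] at a2
  rw [abs_le]
  constructor <;> linarith

/-! ### Classification of the five remaining points -/

/-- The five remaining points of the cubic arrangement. -/
def cubicTail : Set E3 :=
  {stripPoint (1 / 2) (-1), stripPoint (-1 / 2) (-1), stripPoint 0 0, stripPoint (1 / 2) 1,
    stripPoint (-1 / 2) 1}

/-- The five remaining points of a hexagonal arrangement; `ε = ± 1` distinguishes its two mirror
images. -/
def hexagonalTail (ε : ℝ) : Set E3 :=
  {stripPoint (1 / 2) (ε * -1), stripPoint (-1 / 2) (ε * -1), stripPoint (1 / 2) (ε * excess),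
    stripPoint (-1 / 2) (ε * excess), stripPoint 0 (ε * (1 + excess))}

/-- A point of the strip that satisfies the constraints imposed by the star. -/
def Admissible (x : E3) : Prop := InStrip x ∧ |lon x| ≤ 1 + excess - excess * height x

theorem eq_stripPoint_of_sign {x : E3} {ε u s : ℝ} (hx : ‖x‖ = 1) (hε : ε = 1 ∨ ε = -1)
    (h0 : 0 ≤ ε * x 0) (hu : height x = u) (hs : lon x = s) : x = stripPoint (ε * (u / 2)) s := by
  rw [eq_stripPoint hx, hs]
  congr 1
  rw [← hu, height]
  rcases hε with rfl | rfl
  · rw [abs_of_nonneg (by linarith)]; ring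
  · rw [abs_of_nonpos (by linarith)]; ring

/-- The sign ε turns the axis so that the row of three is on the nonnegative side. The sign
conditions are not strict because an equatorial point may be counted in either row. -/
theorem tail_classification {x₁ x₂ x₃ y₁ y₂ : E3} {ε : ℝ} (hε : ε = 1 ∨ ε = -1)
    (a₁ : Admissible x₁) (a₂ : Admissible x₂) (a₃ : Admissible x₃)
    (b₁ : Admissible y₁) (b₂ : Admissible y₂)
    (s₁ : 0 ≤ ε * x₁ 0) (s₂ : 0 ≤ ε * x₂ 0) (s₃ : 0 ≤ ε * x₃ 0)
    (t₁ : ε * y₁ 0 ≤ 0) (t₂ : ε * y₂ 0 ≤ 0)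
    (o₁₂ : lon x₁ ≤ lon x₂) (o₂₃ : lon x₂ ≤ lon x₃) (o : lon y₁ ≤ lon y₂)
    (hx₁₂ : inner ℝ x₁ x₂ ≤ 1 / 2) (hx₂₃ : inner ℝ x₂ x₃ ≤ 1 / 2) (hy : inner ℝ y₁ y₂ ≤ 1 / 2)
    (hxy : ∀ x ∈ ({x₁, x₂, x₃} : Set E3), ∀ y ∈ ({y₁, y₂} : Set E3), inner ℝ x y ≤ 1 / 2) :
    ({x₁, x₂, x₃, y₁, y₂} : Set E3) = cubicTail ∨
      ({x₁, x₂, x₃, y₁, y₂} : Set E3) = hexagonalTail 1 ∨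
        ({x₁, x₂, x₃, y₁, y₂} : Set E3) = hexagonalTail (-1) := by
  have hprod : ∀ {x y : E3}, 0 ≤ ε * x 0 → 0 ≤ ε * y 0 → 0 ≤ x 0 * y 0 := by
    intro x y h1 h2
    have := mul_nonneg h1 h2
    rcases hε with rfl | rfl <;> linarith
  have hprod' : ∀ {x y : E3}, ε * x 0 ≤ 0 → ε * y 0 ≤ 0 → 0 ≤ x 0 * y 0 := by
    intro x y h1 h2
    have := mul_nonneg_of_nonpos_of_nonpos h1 h2
    rcases hε with rfl | rfl <;> linarith
  have hcross : ∀ {x y : E3}, 0 ≤ ε * x 0 → ε * y 0 ≤ 0 → x 0 * y 0 ≤ 0 := by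
    intro x y h1 h2
    have := mul_nonpos_of_nonneg_of_nonpos h1 h2
    rcases hε with rfl | rfl <;> linarith
  have g₁₂ := lon_gap_of_nonneg a₁.1 a₂.1 hx₁₂ (hprod s₁ s₂)
  have g₂₃ := lon_gap_of_nonneg a₂.1 a₃.1 hx₂₃ (hprod s₂ s₃)
  have g := lon_gap_of_nonneg b₁.1 b₂.1 hy (hprod' t₁ t₂)
  rw [abs_sub_comm, abs_of_nonneg (sub_nonneg.2 o₁₂)] at g₁₂
  rw [abs_sub_comm, abs_of_nonneg (sub_nonneg.2 o₂₃)] at g₂₃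
  rw [abs_sub_comm, abs_of_nonneg (sub_nonneg.2 o)] at g
  have hP : StripPacking excess (height x₁) (height x₂) (height x₃) (height y₁) (height y₂)
      (lon x₁) (lon x₂) (lon x₃) (lon y₁) (lon y₂) :=
    { k_pos := excess_pos
      k_le := excess_le
      P₁_mem := height_mem a₁.1
      P₂_mem := height_mem a₂.1
      P₃_mem := height_mem a₃.1
      Q₁_mem := height_mem b₁.1
      Q₂_mem := height_mem b₂.1
      p₁_low := by linarith [(abs_le.1 a₁.2).1]
      p₁₂ := g₁₂
      p₂₃ := g₂₃
      p₃_high := (abs_le.1 a₃.2).2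
      q₁_low := by linarith [(abs_le.1 b₁.2).1]
      q₁₂ := g
      q₂_high := (abs_le.1 b₂.2).2
      p₁q₁ := lon_gap_of_nonpos a₁.1 b₁.1 (hxy _ (by simp) _ (by simp)) (hcross s₁ t₁)
      p₂q₁ := lon_gap_of_nonpos a₂.1 b₁.1 (hxy _ (by simp) _ (by simp)) (hcross s₂ t₁)
      p₃q₁ := lon_gap_of_nonpos a₃.1 b₁.1 (hxy _ (by simp) _ (by simp)) (hcross s₃ t₁)
      p₁q₂ := lon_gap_of_nonpos a₁.1 b₂.1 (hxy _ (by simp) _ (by simp)) (hcross s₁ t₂)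
      p₂q₂ := lon_gap_of_nonpos a₂.1 b₂.1 (hxy _ (by simp) _ (by simp)) (hcross s₂ t₂)
      p₃q₂ := lon_gap_of_nonpos a₃.1 b₂.1 (hxy _ (by simp) _ (by simp)) (hcross s₃ t₂) }
  have hε' : -ε = 1 ∨ -ε = -1 := by
    rcases hε with rfl | rfl <;> norm_num
  have t₁' : 0 ≤ -ε * y₁ 0 := by linarith
  have t₂' : 0 ≤ -ε * y₂ 0 := by linarith
  rcases hP.classification with h | h | h <;>
    obtain ⟨h1, h2, h3, h4, h5, h6, h7, h8, h9, h10⟩ := h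
  · left
    rw [eq_stripPoint_of_sign a₁.1.1 hε s₁ h1 h6, eq_stripPoint_of_sign a₂.1.1 hε s₂ h2 h7,
      eq_stripPoint_of_sign a₃.1.1 hε s₃ h3 h8, eq_stripPoint_of_sign b₁.1.1 hε' t₁' h4 h9,
      eq_stripPoint_of_sign b₂.1.1 hε' t₂' h5 h10]
    rcases hε with rfl | rfl <;> ext v <;> simp [cubicTail, neg_div] <;> tauto
  · right; left
    rw [eq_stripPoint_of_sign a₁.1.1 hε s₁ h1 h6, eq_stripPoint_of_sign a₂.1.1 hε s₂ h2 h7,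
      eq_stripPoint_of_sign a₃.1.1 hε s₃ h3 h8, eq_stripPoint_of_sign b₁.1.1 hε' t₁' h4 h9,
      eq_stripPoint_of_sign b₂.1.1 hε' t₂' h5 h10]
    rcases hε with rfl | rfl <;> ext v <;> 
      simp only [hexagonalTail, Set.mem_insert_iff, Set.mem_singleton_iff] <;> norm_num <;>
      constructor <;> rintro (h | h | h | h | h) <;> simp [h]
  · right; right
    rw [neg_eq_iff_eq_neg] at h6 h7 h8 h9 h10
    rw [eq_stripPoint_of_sign a₁.1.1 hε s₁ h3 h8, eq_stripPoint_of_sign a₂.1.1 hε s₂ h2 h7,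
      eq_stripPoint_of_sign a₃.1.1 hε s₃ h1 h6, eq_stripPoint_of_sign b₁.1.1 hε' t₁' h5 h10,
      eq_stripPoint_of_sign b₂.1.1 hε' t₂' h4 h9]
    rcases hε with rfl | rfl <;> ext v <;> 
      simp only [hexagonalTail, Set.mem_insert_iff, Set.mem_singleton_iff] <;> norm_num <;>
      constructor <;> rintro (h | h | h | h | h) <;> simp [h]

/-- Pigeonhole: the integer parts of f + K are distinct and lie in {0, 1, 2}. -/
theorem card_le_three_of_gaps {ι : Type*} (T : Finset ι) (f : ι → ℝ) {K : ℝ} (hK : 2 * K < 3)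
    (hf : ∀ x ∈ T, |f x| ≤ K) (hgap : ∀ x ∈ T, ∀ y ∈ T, x ≠ y → 1 ≤ |f x - f y|) :
    T.card ≤ 3 := by
  have hmaps : ∀ x ∈ T, ⌊f x + K⌋ ∈ Finset.Ico (0 : ℤ) 3 := by
    intro x hx
    obtain ⟨h1, h2⟩ := abs_le.1 (hf x hx)
    rw [Finset.mem_Ico, Int.le_floor, Int.floor_lt]
    constructor
    · push_cast; linarith
    · push_cast; linarith
  refine (Finset.card_le_card_of_injOn (fun x => ⌊f x + K⌋) hmaps ?_).trans (by simp)
  intro x hx y hy hxy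
  by_contra hne
  have h1 := hgap x hx y hy hne
  have h2 := Int.abs_sub_lt_one_of_floor_eq_floor hxy
  rw [add_sub_add_right_eq_sub] at h2
  linarith

theorem exists_sorted_pair {ι : Type*} [DecidableEq ι] {T : Finset ι} (f : ι → ℝ)
    (hT : T.card = 2) : ∃ a b, a ≠ b ∧ T = {a, b} ∧ f a ≤ f b := by
  obtain ⟨a, b, hab, rfl⟩ := Finset.card_eq_two.1 hT
  rcases le_total (f a) (f b) with h | h
  · exact ⟨a, b, hab, rfl, h⟩
  · exact ⟨b, a, hab.symm, Finset.pair_comm a b, h⟩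

theorem exists_sorted_triple {ι : Type*} [DecidableEq ι] {T : Finset ι} (f : ι → ℝ)
    (hT : T.card = 3) :
    ∃ a b c, a ≠ b ∧ b ≠ c ∧ T = {a, b, c} ∧ f a ≤ f b ∧ f b ≤ f c := by
  obtain ⟨a, ha, hmin⟩ := T.exists_min_image f (Finset.card_pos.1 (by omega))
  obtain ⟨b, c, hbc, he, hle⟩ := exists_sorted_pair f (T := T.erase a)
    (by rw [Finset.card_erase_of_mem ha, hT])
  have hb : b ∈ T.erase a := by rw [he]; simp
  refine ⟨a, b, c, (Finset.ne_of_mem_erase hb).symm, hbc, ?_, hmin b (Finset.mem_of_mem_erase hb), hle⟩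
  rw [← he, Finset.insert_erase ha]

theorem frameConfig_ncard : frameConfig.ncard = 7 := by
  have h2 : √2 / 2 ≠ -√2 / 2 := fun h => by linarith [Real.sqrt_pos.2 (zero_lt_two' ℝ)]
  have h2' := h2.symm
  rw [frameConfig]
  repeat rw [Set.ncard_insert_of_notMem]
  · rw [Set.ncard_singleton]
  all_goals
    simp only [Set.mem_insert_iff, Set.mem_singleton_iff, WithLp.toLp.injEq, Matrix.vecCons_inj]
    norm_num [h2, h2']

/-- Outside the frame there are five points, at most three on each side of the equator; ε records
which side has three. -/
theorem union_classification {S : Set E3} (hS : ∀ x ∈ S, ‖x‖ = 1) (hcard : S.ncard = 12)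
    (hdist : ∀ x ∈ S, ∀ y ∈ S, x ≠ y → inner ℝ x y ≤ 1 / 2) (hframe : frameConfig ⊆ S) :
    S = frameConfig ∪ cubicTail ∨ S = frameConfig ∪ hexagonalTail 1 ∨
      S = frameConfig ∪ hexagonalTail (-1) := by
  classical
  have hfin : S.Finite := Set.finite_of_ncard_ne_zero (by omega)
  have hfinT : (S \ frameConfig).Finite := hfin.subset Set.sdiff_subset
  have hcardT : (S \ frameConfig).ncard = 5 := by
    rw [Set.ncard_sdiff hframe (hfin.subset hframe), hcard, frameConfig_ncard]
  obtain ⟨T, hT⟩ := hfinT.exists_finset_coe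
  rw [← hT, Set.ncard_coe_finset] at hcardT
  have hmem : ∀ x ∈ T, x ∈ S ∧ Admissible x := by
    intro x hx
    have hx' : x ∈ S \ frameConfig := by rw [← hT]; exact hx
    have hin : ∀ y ∈ frameConfig, inner ℝ x y ≤ 1 / 2 := fun y hy =>
      hdist x hx'.1 y (hframe hy) (fun h => hx'.2 (h ▸ hy))
    exact ⟨hx'.1, inStrip_of_frame (hS x hx'.1) hin, abs_lon_le_of_frame (hS x hx'.1) hin⟩
  have hsplit := T.card_filter_add_card_filter_not (fun x : E3 => 0 ≤ x 0)
  have hunion := T.filter_union_filter_not_eq (fun x : E3 => 0 ≤ x 0)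
  have hgaps : ∀ U ⊆ T, (∀ x ∈ U, ∀ y ∈ U, 0 ≤ x 0 * y 0) → U.card ≤ 3 := by
    intro U hU hsign
    refine card_le_three_of_gaps U lon (K := 1 + excess) (by linarith [excess_le]) ?_ ?_
    · intro x hx
      have h := (hmem x (hU hx)).2
      linarith [h.2, mul_nonneg excess_pos.le (height_mem h.1).1]
    · intro x hx y hy hxy
      have h := hmem x (hU hx)
      have h' := hmem y (hU hy)
      have := lon_gap_of_nonneg h.2.1 h'.2.1 (hdist x h.1 y h'.1 hxy) (hsign x hx y hy)
      linarith [mul_nonneg excess_pos.le (mul_nonneg (height_mem h.2.1).1 (height_mem h'.2.1).1)]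
  have hT' : S = frameConfig ∪ T := by rw [hT, Set.union_sdiff_cancel hframe]
  have main : ∀ (ε : ℝ) (U V : Finset E3), ε = 1 ∨ ε = -1 → U.card = 3 → V.card = 2 →
      (∀ x ∈ U, 0 ≤ ε * x 0) → (∀ x ∈ V, ε * x 0 ≤ 0) → U ∪ V = T → Disjoint U V →
      (T : Set E3) = cubicTail ∨ (T : Set E3) = hexagonalTail 1 ∨
        (T : Set E3) = hexagonalTail (-1) := by
    intro ε U V hε hU hV hUs hVs hUV hdisj
    obtain ⟨a, b, c, hab, hbc, rfl, h1, h2⟩ := exists_sorted_triple lon hU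
    obtain ⟨d, e, hde, rfl, h3⟩ := exists_sorted_pair lon hV
    have hTset : (T : Set E3) = {a, b, c, d, e} := by
      rw [← hUV]
      ext v
      simp
      tauto
    have hm : ∀ x ∈ ({a, b, c, d, e} : Set E3), x ∈ S ∧ Admissible x := by
      rw [← hTset]
      exact fun x hx => hmem x hx
    rw [hTset]
    refine tail_classification hε (hm a (by simp)).2 (hm b (by simp)).2 (hm c (by simp)).2
      (hm d (by simp)).2 (hm e (by simp)).2 (hUs a (by simp)) (hUs b (by simp)) (hUs c (by simp))
      (hVs d (by simp)) (hVs e (by simp)) h1 h2 h3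
      (hdist _ (hm a (by simp)).1 _ (hm b (by simp)).1 hab)
      (hdist _ (hm b (by simp)).1 _ (hm c (by simp)).1 hbc)
      (hdist _ (hm d (by simp)).1 _ (hm e (by simp)).1 hde) ?_
    intro x hx y hy
    have hx' : x ∈ ({a, b, c} : Finset E3) := by simpa using hx
    have hy' : y ∈ ({d, e} : Finset E3) := by simpa using hy
    refine hdist x (hmem x ?_).1 y (hmem y ?_).1
      (fun h => Finset.disjoint_left.1 hdisj hx' (h ▸ hy'))
    · rw [← hUV]; exact Finset.mem_union_left _ hx'
    · rw [← hUV]; exact Finset.mem_union_right _ hy'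
  have hA := hgaps (T.filter fun x : E3 => 0 ≤ x 0) (Finset.filter_subset _ _)
    fun x hx y hy => mul_nonneg (Finset.mem_filter.1 hx).2 (Finset.mem_filter.1 hy).2
  have hB := hgaps (T.filter fun x : E3 => ¬ 0 ≤ x 0) (Finset.filter_subset _ _)
    fun x hx y hy => mul_nonneg_of_nonpos_of_nonpos (not_le.1 (Finset.mem_filter.1 hx).2).le
      (not_le.1 (Finset.mem_filter.1 hy).2).le
  have hdisj := Finset.disjoint_filter_filter_not T T (fun x : E3 => 0 ≤ x 0)
  have hres : (T : Set E3) = cubicTail ∨ (T : Set E3) = hexagonalTail 1 ∨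
        (T : Set E3) = hexagonalTail (-1) := by
    rcases (by omega : (T.filter fun x : E3 => 0 ≤ x 0).card = 3 ∧
        (T.filter fun x : E3 => ¬ 0 ≤ x 0).card = 2 ∨
        (T.filter fun x : E3 => ¬ 0 ≤ x 0).card = 3 ∧
        (T.filter fun x : E3 => 0 ≤ x 0).card = 2) with ⟨h3, h2⟩ | ⟨h3, h2⟩
    · refine main 1 _ _ (.inl rfl) h3 h2 ?_ ?_ hunion hdisj
      · intro x hx
        linarith [(Finset.mem_filter.1 hx).2]
      · intro x hx
        linarith [not_le.1 (Finset.mem_filter.1 hx).2]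
    · refine main (-1) _ _ (.inr rfl) h3 h2 ?_ ?_ (by rw [Finset.union_comm]; exact hunion)
        hdisj.symm
      · intro x hx
        linarith [not_le.1 (Finset.mem_filter.1 hx).2]
      · intro x hx
        linarith [(Finset.mem_filter.1 hx).2]
  rw [hT']
  rcases hres with h | h | h <;> rw [h] <;> simp

/-! ### Coordinates and congruence with the two configurations -/

theorem vec_eq {a b c a' b' c' : ℝ} (ha : a = a') (hb : b = b') (hc : c = c') :
    (!₂[a, b, c] : E3) = !₂[a', b', c'] := by
  rw [ha, hb, hc]

theorem stripPoint_one {w : ℝ} (hw : w ^ 2 = 1 / 4) :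
    stripPoint w 1 = !₂[w, 1 / 2, √2 / 2] := by
  rw [stripPoint_of_sq hw, mul_one, cos_magic, sin_magic]
  exact vec_eq rfl (by field_simp) (by field_simp)

theorem stripPoint_excess {w : ℝ} (hw : w ^ 2 = 1 / 4) :
    stripPoint w excess = !₂[w, 5 / 6, √2 / 6] := by
  rw [stripPoint_of_sq hw, mul_comm magic, excess_mul_magic, Real.cos_pi_sub, Real.sin_pi_sub,
    cos_three_magic, sin_three_magic]
  exact vec_eq rfl (by field_simp; norm_num) (by field_simp; norm_num)

theorem stripPoint_one_add_excess : stripPoint 0 (1 + excess) = !₂[0, 1 / 3, 2 * √2 / 3] := by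
  have h : magic * (1 + excess) = Real.pi - 2 * magic := by linarith [excess_mul_magic]
  have h3 : √3 ^ 2 = 3 := Real.sq_sqrt (by norm_num)
  have h0 : √3 ≠ 0 := by positivity
  rw [stripPoint, h, Real.cos_pi_sub, Real.sin_pi_sub, Real.cos_two_mul, Real.sin_two_mul,
    cos_magic, sin_magic, div_pow, h3]
  refine vec_eq rfl (by norm_num) ?_
  norm_num
  field_simp
  linarith

theorem cubicTail_eq : cubicTail =
    {!₂[1 / 2, 1 / 2, -√2 / 2], !₂[-1 / 2, 1 / 2, -√2 / 2], !₂[0, 1, 0],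
      !₂[1 / 2, 1 / 2, √2 / 2], !₂[-1 / 2, 1 / 2, √2 / 2]} := by
  rw [cubicTail, stripPoint_neg, stripPoint_neg, stripPoint_one (by norm_num),
    stripPoint_one (by norm_num), show stripPoint 0 0 = !₂[0, 1, 0] by simp [stripPoint]]
  simp [neg_div]

theorem stripPoint_mul {ε : ℝ} (hε : ε = 1 ∨ ε = -1) (w s : ℝ) : stripPoint w (ε * s) =
    !₂[stripPoint w s 0, stripPoint w s 1, ε * stripPoint w s 2] := by
  rcases hε with rfl | rfl
  · simp [stripPoint]
  · rw [neg_one_mul, stripPoint_neg, neg_one_mul]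

theorem hexagonalTail_eq {ε : ℝ} (hε : ε = 1 ∨ ε = -1) : hexagonalTail ε =
    {!₂[1 / 2, 1 / 2, -(ε * (√2 / 2))], !₂[-1 / 2, 1 / 2, -(ε * (√2 / 2))],
      !₂[1 / 2, 5 / 6, ε * (√2 / 6)], !₂[-1 / 2, 5 / 6, ε * (√2 / 6)],
      !₂[0, 1 / 3, ε * (2 * √2 / 3)]} := by
  rw [hexagonalTail]
  simp only [stripPoint_mul hε, stripPoint_neg, stripPoint_one_add_excess]
  rw [stripPoint_one (by norm_num), stripPoint_one (by norm_num), stripPoint_excess (by norm_num),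
    stripPoint_excess (by norm_num)]
  simp

theorem exists_isometry_of_orthonormal {e : Fin 3 → E3} (he : Orthonormal ℝ e) :
    ∃ g : E3 ≃ₗᵢ[ℝ] E3, ∀ x i, g x i = inner ℝ (e i) x := by
  let b := (basisOfOrthonormalOfCardEqFinrank he (by simp)).toOrthonormalBasis
    (by simpa using he)
  refine ⟨b.repr, fun x i => ?_⟩
  rw [b.repr_apply_apply]
  simp [b]

theorem orthonormal_fin_three {u v w : E3} (hu : ‖u‖ = 1) (hv : ‖v‖ = 1) (hw : ‖w‖ = 1)
    (huv : inner ℝ u v = 0) (huw : inner ℝ u w = 0) (hvw : inner ℝ v w = 0) :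
    Orthonormal ℝ ![u, v, w] := by
  have hvu := (real_inner_comm u v).trans huv
  have hwu := (real_inner_comm u w).trans huw
  have hwv := (real_inner_comm v w).trans hvw
  constructor
  · intro i
    fin_cases i <;> simpa
  · intro i j hij
    fin_cases i <;> fin_cases j <;> simp_all

theorem norm_eq_one_of {a b c : ℝ} (h : a ^ 2 + b ^ 2 + c ^ 2 = 1) : ‖(!₂[a, b, c] : E3)‖ = 1 := by
  have := E3_norm_sq !₂[a, b, c]
  simp only [Matrix.cons_val_zero, Matrix.cons_val_one, Matrix.cons_val] at this
  rw [h] at this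
  exact (pow_eq_one_iff_of_nonneg (norm_nonneg _) two_ne_zero).1 this

theorem exists_isometry_of_rows {a b c a' b' c' a'' b'' c'' : ℝ} (h1 : a ^ 2 + b ^ 2 + c ^ 2 = 1)
    (h2 : a' ^ 2 + b' ^ 2 + c' ^ 2 = 1) (h3 : a'' ^ 2 + b'' ^ 2 + c'' ^ 2 = 1)
    (h12 : a * a' + b * b' + c * c' = 0) (h13 : a * a'' + b * b'' + c * c'' = 0)
    (h23 : a' * a'' + b' * b'' + c' * c'' = 0) :
    ∃ g : E3 ≃ₗᵢ[ℝ] E3, ∀ x y z : ℝ, g !₂[x, y, z] =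
      !₂[a * x + b * y + c * z, a' * x + b' * y + c' * z, a'' * x + b'' * y + c'' * z] := by
  obtain ⟨g, hg⟩ := exists_isometry_of_orthonormal (orthonormal_fin_three (norm_eq_one_of h1)
    (norm_eq_one_of h2) (norm_eq_one_of h3) (by rw [E3_inner]; simpa using h12)
    (by rw [E3_inner]; simpa using h13) (by rw [E3_inner]; simpa using h23))
  refine ⟨g, fun x y z => ?_⟩
  ext i
  rw [hg, E3_inner]
  fin_cases i <;> simp

theorem congruent_fcc : CongruentOnSphere (frameConfig ∪ cubicTail) fccConfig := by
  have h22 : √2 * √2 = 2 := Real.mul_self_sqrt (by norm_num)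
  -- The antipodal vertices ±(1, -1, 0)/√2 go to the poles and (1, 1, 0)/√2 goes to the centre of
  -- the star.
  obtain ⟨g, hg⟩ := exists_isometry_of_rows (a := √2 / 2) (b := -√2 / 2) (c := 0) (a' := -√2 / 2)
    (b' := -√2 / 2) (c' := 0) (a'' := 0) (b'' := 0) (c'' := 1) (by linarith) (by linarith)
    (by linarith) (by linarith) (by linarith) (by linarith)
  have hinv : (√2)⁻¹ = √2 / 2 := by
    rw [inv_eq_iff_eq_inv, inv_div]
    field_simp
    linarith
  refine ⟨g, ?_⟩
  have key : ∀ x y z : ℝ, g ((√2)⁻¹ • !₂[x, y, z]) =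
      !₂[(x - y) / 2, -(x + y) / 2, z * (√2 / 2)] := by
    intro x y z
    rw [map_smul, hg, hinv, ← WithLp.toLp_smul]
    simp only [Matrix.smul_cons, smul_eq_mul, Matrix.smul_empty]
    exact vec_eq (by linarith [congrArg (· * (x - y)) h22])
      (by linarith [congrArg (· * (x + y)) h22]) (by ring)
  rw [cubicTail_eq, fccConfig, frameConfig]
  simp only [Set.image_insert_eq, Set.image_singleton, key]
  ext v
  simp only [Set.mem_insert_iff, Set.mem_singleton_iff, Set.mem_union]
  constructor
  · rintro (h | h | h | h | h | h | h | h | h | h | h | h) <;> norm_num [h, neg_div]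
  · rintro ((h | h | h | h | h | h | h) | h | h | h | h | h) <;> norm_num [h, neg_div]

theorem congruent_hcp {ε : ℝ} (hε : ε = 1 ∨ ε = -1) :
    CongruentOnSphere (frameConfig ∪ hexagonalTail ε) hcpConfig := by
  have h22 : √2 * √2 = 2 := Real.mul_self_sqrt (by norm_num)
  have h33 : √3 * √3 = 3 := Real.mul_self_sqrt (by norm_num)
  have h6 : √6 = √2 * √3 := by rw [← Real.sqrt_mul (by norm_num)]; norm_num
  have h66 : √6 * √6 = 6 := Real.mul_self_sqrt (by norm_num)
  have h36 : √3 * √6 = 3 * √2 := by rw [h6]; linarith [congrArg (· * √2) h33]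
  have hεε : ε * ε = 1 := by rcases hε with rfl | rfl <;> norm_num
  -- The hexagon vertices (±1, 0, 0) are the poles and stay fixed; (0, -√3/3, -√6/3) goes to the
  -- centre of the star. The sign ε reflects the third coordinate.
  obtain ⟨g, hg⟩ := exists_isometry_of_rows (a := 1) (b := 0) (c := 0) (a' := 0)
    (b' := √3 / 3) (c' := √6 / 3) (a'' := 0) (b'' := -(ε * √6) / 3) (c'' := ε * √3 / 3)
    (by linarith) (by linarith)
    (by linarith [congrArg (· * (ε * ε)) h33, congrArg (· * (ε * ε)) h66])
    (by linarith) (by linarith) (by linarith)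
  refine ⟨g, ?_⟩
  have key : ∀ x y z b c : ℝ, √3 / 3 * y + √6 / 3 * z = b →
      -(ε * √6) / 3 * y + ε * √3 / 3 * z = c → g !₂[x, y, z] = !₂[x, b, c] := by
    intro x y z b c hb hc
    rw [hg]
    exact vec_eq (by ring) (by linarith) (by linarith)
  have e1 : ∀ x, g !₂[x, 0, 0] = !₂[x, 0, 0] := fun x => key _ _ _ _ _ (by ring) (by ring)
  have e2 : ∀ x, g !₂[x, √3 / 2, 0] = !₂[x, 1 / 2, -(ε * (√2 / 2))] := fun x =>
    key _ _ _ _ _ (by linarith) (by linarith [congrArg (ε * ·) h36])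
  have e3 : ∀ x, g !₂[x, -√3 / 2, 0] = !₂[x, -1 / 2, ε * (√2 / 2)] := fun x =>
    key _ _ _ _ _ (by linarith) (by linarith [congrArg (ε * ·) h36])
  have e4 : ∀ x, g !₂[x, √3 / 6, √6 / 3] = !₂[x, 5 / 6, ε * (√2 / 6)] := fun x =>
    key _ _ _ _ _ (by linarith) (by linarith [congrArg (ε * ·) h36])
  have e5 : ∀ x, g !₂[x, √3 / 6, -√6 / 3] = !₂[x, -1 / 2, -(ε * (√2 / 2))] := fun x =>
    key _ _ _ _ _ (by linarith) (by linarith [congrArg (ε * ·) h36])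
  have e6 : ∀ x, g !₂[x, -√3 / 3, √6 / 3] = !₂[x, 1 / 3, ε * (2 * √2 / 3)] := fun x =>
    key _ _ _ _ _ (by linarith) (by linarith [congrArg (ε * ·) h36])
  have e7 : ∀ x, g !₂[x, -√3 / 3, -√6 / 3] = !₂[x, -1, 0] := fun x =>
    key _ _ _ _ _ (by linarith) (by linarith [congrArg (ε * ·) h36])
  rw [hexagonalTail_eq hε, hcpConfig, frameConfig]
  simp only [Set.image_insert_eq, Set.image_singleton, e1, e2, e3, e4, e5, e6, e7]
  ext v
  simp only [Set.mem_insert_iff, Set.mem_singleton_iff, Set.mem_union]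
  rcases hε with rfl | rfl
  · constructor
    · rintro (h | h | h | h | h | h | h | h | h | h | h | h) <;> norm_num [h, neg_div]
    · rintro ((h | h | h | h | h | h | h) | h | h | h | h | h) <;> norm_num [h, neg_div]
  · constructor
    · rintro (h | h | h | h | h | h | h | h | h | h | h | h) <;> norm_num [h, neg_div]
    · rintro ((h | h | h | h | h | h | h) | h | h | h | h | h) <;> norm_num [h, neg_div]

/-! ### From the star to the seven fixed points -/

/-- By Krein–Milman a face is the closed convex hull of its extreme points, which lie in S, and two
points span at most a line. This excludes the squares with a = c and b = d that `IsSquare4` permits.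
-/
theorem IsFace.not_subset_pair {S F : Set E3} (hS : S.Finite) (hF : IsFace S F) (a b : E3) :
    ¬ F ⊆ {a, b} := by
  rintro hsub
  obtain ⟨G, hG, hrank, rfl⟩ := hF
  have hhull : IsCompact (convexHull ℝ S) := hS.isCompact_convexHull ℝ
  have hGc : IsCompact G := hG.isCompact hhull
  have hGconv : Convex ℝ G := hG.convex (convex_convexHull ℝ S)
  have hext : G.extremePoints ℝ ⊆ S ∩ G := fun x hx =>
    ⟨extremePoints_convexHull_subset (hG.isExtreme.extremePoints_subset_extremePoints hx),
      extremePoints_subset hx⟩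
  have hGsub : G ⊆ convexHull ℝ ({a, b} : Set E3) := by
    rw [← closure_convexHull_extremePoints hGc hGconv]
    refine closure_minimal (convexHull_mono (hext.trans hsub)) ?_
    exact ((Set.toFinite _).isCompact_convexHull ℝ).isClosed
  have h1 : vectorSpan ℝ G ≤ vectorSpan ℝ ({a, b} : Set E3) := by
    refine (vectorSpan_mono ℝ hGsub).trans ?_
    rw [← direction_affineSpan, affineSpan_convexHull, direction_affineSpan]
  have h2 := Submodule.finrank_mono h1
  have h3 := collinear_iff_finrank_le_one.1 (collinear_pair ℝ a b)
  omega

theorem inner_of_angle {x y : E3} (hx : ‖x‖ = 1) (hy : ‖y‖ = 1)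
    (h : InnerProductGeometry.angle x y = Real.pi / 3) : inner ℝ x y = 1 / 2 := by
  rw [← InnerProductGeometry.cos_angle_mul_norm_mul_norm, h, hx, hy, Real.cos_pi_div_three]
  norm_num

theorem inner_le_of_angle {x y : E3} (hx : ‖x‖ = 1) (hy : ‖y‖ = 1)
    (h : Real.pi / 3 ≤ InnerProductGeometry.angle x y) : inner ℝ x y ≤ 1 / 2 := by
  rw [← InnerProductGeometry.cos_angle_mul_norm_mul_norm, hx, hy, mul_one, mul_one,
    ← Real.cos_pi_div_three]
  exact Real.cos_le_cos_of_nonneg_of_le_pi (by positivity) (InnerProductGeometry.angle_le_pi _ _) h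

theorem eq_zero_of_orthogonal_triple {p q u d : E3} (hp : p ≠ 0) (hq : q ≠ 0) (hu : u ≠ 0)
    (hpq : inner ℝ p q = 0) (hpu : inner ℝ p u = 0) (hqu : inner ℝ q u = 0)
    (hpd : inner ℝ p d = 0) (hqd : inner ℝ q d = 0) (hud : inner ℝ u d = 0) : d = 0 := by
  by_contra hd
  have hli : LinearIndependent ℝ ![p, q, u, d] := by
    refine linearIndependent_of_ne_zero_of_inner_eq_zero ?_ ?_
    · intro i
      fin_cases i <;> simpa
    · intro i j hij
      have h1 := (real_inner_comm p q).trans hpq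
      have h2 := (real_inner_comm p u).trans hpu
      have h3 := (real_inner_comm q u).trans hqu
      have h4 := (real_inner_comm p d).trans hpd
      have h5 := (real_inner_comm q d).trans hqd
      have h6 := (real_inner_comm u d).trans hud
      fin_cases i <;> fin_cases j <;> simp_all
  have := hli.fintype_card_le_finrank
  simp at this

/-- A rhombus with sides `π / 3` and equal diagonals is a square or degenerates to a segment. -/
theorem IsSquare4.degenerate_or {a b c d : E3} (ha : ‖a‖ = 1) (hb : ‖b‖ = 1) (hc : ‖c‖ = 1)
    (hd : ‖d‖ = 1) (h : IsSquare4 a b c d) :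
    (a = c ∧ b = d) ∨ (inner ℝ b d = 0 ∧ c = b + d - a) := by
  obtain ⟨hab, hbc, hcd, hda, he⟩ := h
  have iab := inner_of_angle ha hb hab
  have ibc := inner_of_angle hb hc hbc
  have icd := inner_of_angle hc hd hcd
  have ida := inner_of_angle hd ha hda
  have iba := (real_inner_comm a b).trans iab
  have icb := (real_inner_comm b c).trans ibc
  have idc := (real_inner_comm c d).trans icd
  have iad := (real_inner_comm d a).trans ida
  have ie : inner ℝ a c = inner ℝ b d := by
    rw [← InnerProductGeometry.cos_angle_mul_norm_mul_norm, he,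
      ← InnerProductGeometry.cos_angle_mul_norm_mul_norm, ha, hb, hc, hd]
  have ica := real_inner_comm a c
  have idb := real_inner_comm b d
  have haa : inner ℝ a a = 1 := by rw [real_inner_self_eq_norm_sq, ha]; norm_num
  have hbb : inner ℝ b b = 1 := by rw [real_inner_self_eq_norm_sq, hb]; norm_num
  have hcc : inner ℝ c c = 1 := by rw [real_inner_self_eq_norm_sq, hc]; norm_num
  have hdd : inner ℝ d d = 1 := by rw [real_inner_self_eq_norm_sq, hd]; norm_num
  by_cases hac : a = c
  · left
    refine ⟨hac, (inner_eq_one_iff_of_norm_eq_one (𝕜 := ℝ) hb hd).1 ?_⟩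
    rw [← ie, ← hac, haa]
  by_cases hbd : b = d
  · exact absurd ((inner_eq_one_iff_of_norm_eq_one (𝕜 := ℝ) ha hc).1 (by rw [ie, ← hbd, hbb])) hac
  right
  obtain ⟨t, ht⟩ : ∃ t : ℝ, t = inner ℝ b d := ⟨_, rfl⟩
  rw [← ht] at ie idb ⊢
  rw [ie] at ica
  have hu : a + c ≠ 0 := by
    intro h0
    have : inner ℝ (a + c) b = 0 := by rw [h0, inner_zero_left]
    rw [inner_add_left, iab, icb] at this
    norm_num at this
  have hpos : 0 < 2 + 2 * t := by
    have h1 := real_inner_self_pos.2 hu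
    rw [inner_add_add_self, haa, hcc, ie, ica] at h1
    linarith
  -- The vectors a - c, b - d and a + c are pairwise orthogonal and so span the space; b + d is
  -- orthogonal to the first two, hence a multiple of a + c. The coefficients come from ⟨a + c, b +
  -- d⟩ = 2 and ‖a + c‖² = 2 + 2t.
  have hzero : (2 + 2 * t) • (b + d) - (2 : ℝ) • (a + c) = 0 := by
    refine eq_zero_of_orthogonal_triple (sub_ne_zero.2 hac) (sub_ne_zero.2 hbd) hu ?_ ?_ ?_ ?_ ?_ ?_
      <;> simp only [inner_sub_left, inner_add_left, inner_sub_right, inner_add_right,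
        inner_smul_right, haa, hbb, hcc, hdd, iab, ibc, icd, ida, iba, icb, idc, iad, ie, ica, idb,
        ← ht] <;> ring
  have hsq := congrArg (fun v => inner ℝ v b) hzero
  simp only [inner_sub_left, inner_smul_left, inner_add_left, inner_zero_left, hbb, idb, iab, icb,
    conj_trivial] at hsq
  have ht0 : t = 0 := by
    have h1 : (1 + t) ^ 2 = 1 := by linarith
    nlinarith
  refine ⟨ht0, ?_⟩
  rw [ht0, mul_zero, add_zero, ← smul_sub, smul_eq_zero_iff_right two_ne_zero, sub_eq_zero] at hzero
  rw [hzero]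
  abel

/-- Two points of the sphere are at distance π/3 from both ends of an edge of the star. The one with
z = -√2/6 is on the square's side of that edge and too close to the square's opposite vertex, which
`hC` excludes. -/
theorem star_vertex_eq {x : E3} {ε : ℝ} (hε : ε = 1 ∨ ε = -1) (hx : ‖x‖ = 1) (h1 : x 1 = -1 / 2)
    (hB : inner ℝ x !₂[1 / 2, -1 / 2, ε * (√2 / 2)] = (1 / 2 : ℝ))
    (hC : inner ℝ x !₂[1 / 2, -1 / 2, -(ε * (√2 / 2))] ≤ (1 / 2 : ℝ)) :
    x = !₂[-1 / 2, -1 / 2, ε * (√2 / 2)] := by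
  have h22 : √2 * √2 = 2 := Real.mul_self_sqrt (by norm_num)
  have h2 : 0 < √2 := by positivity
  have hεε : ε * ε = 1 := by rcases hε with rfl | rfl <;> norm_num
  have hn := E3_norm_sq x
  rw [hx, h1] at hn
  rw [E3_inner, h1] at hB hC
  simp only [Matrix.cons_val_zero, Matrix.cons_val_one, Matrix.cons_val] at hB hC
  obtain ⟨z, hz⟩ : ∃ z, z = ε * x 2 := ⟨_, rfl⟩
  have hz2 : z ^ 2 = x 2 ^ 2 := by rw [hz, mul_pow, sq ε, hεε, one_mul]
  have h0 : x 0 = 1 / 2 - √2 * z := by rw [hz]; linarith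
  have hfac : (z - √2 / 2) * (3 * z + √2 / 2) = 0 := by
    rw [h0, ← hz2] at hn
    linarith [congrArg (· * z ^ 2) h22]
  have hz1 : z = √2 / 2 := by
    rcases mul_eq_zero.1 hfac with h | h
    · linarith
    · exfalso
      have hz' : z = -√2 / 6 := by linarith
      have : √2 * z = -1 / 3 := by rw [hz']; linarith
      rw [h0] at hC
      have hC' : 1 / 2 - √2 * z ≤ 1 / 2 := by
        rw [hz] at hC ⊢
        linarith
      linarith
  ext i
  fin_cases i
  · simp
    rw [h0, hz1]
    linarith
  · simp [h1]
  · have : x 2 = ε * z := by rw [hz, ← mul_assoc, hεε, one_mul]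
    simp [this, hz1]

/-- Up to an isometry, a Type-I configuration with a star of type `{△, □, △, □}` contains
`frameConfig`. -/
theorem exists_isometry_frame {S : Set E3} (hS : IsTypeI S) {N : E3} (hN : N ∈ S)
    (hstar : IsStarTSTS S N) : ∃ g : E3 ≃ₗᵢ[ℝ] E3, frameConfig ⊆ g '' S := by
  obtain ⟨hsph, hcard, hdist⟩ := hS
  have hfin : S.Finite := Set.finite_of_ncard_ne_zero (by omega)
  obtain ⟨A, B, W, C, D, E, hfaces, ⟨tNA, tAB, tBN⟩, sq, ⟨tNC, tCD, tDN⟩, sq'⟩ := hstar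
  have hface : ∀ F ∈ ({{N, A, B}, {N, B, W, C}, {N, C, D}, {N, D, E, A}} : Set (Set E3)),
      IsFace S F := by
    rw [← hfaces]
    exact fun F hF => hF.1
  have f2 := hface {N, B, W, C} (by simp)
  have f4 := hface {N, D, E, A} (by simp)
  have hsub : ∀ {F}, IsFace S F → F ⊆ S := by
    rintro F ⟨G, -, -, rfl⟩
    exact Set.inter_subset_left
  have hB := hsub f2 (show B ∈ _ by simp)
  have hW := hsub f2 (show W ∈ _ by simp)
  have hC := hsub f2 (show C ∈ _ by simp)
  have hD := hsub f4 (show D ∈ _ by simp)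
  have hE := hsub f4 (show E ∈ _ by simp)
  have hA := hsub f4 (show A ∈ _ by simp)
  have hnorm : ∀ {x}, x ∈ S → ‖x‖ = 1 := fun hx => by simpa using hsph hx
  have n_N := hnorm hN
  have n_A := hnorm hA
  have n_B := hnorm hB
  have n_C := hnorm hC
  have n_D := hnorm hD
  have n_W := hnorm hW
  have hle : ∀ {x y}, x ∈ S → y ∈ S → x ≠ y → inner ℝ x y ≤ 1 / 2 := fun hx hy hxy =>
    inner_le_of_angle (hnorm hx) (hnorm hy) (hdist hx hy hxy)
  obtain ⟨iBC, rfl⟩ : inner ℝ B C = 0 ∧ W = B + C - N := by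
    rcases sq.degenerate_or n_N n_B n_W n_C with ⟨rfl, rfl⟩ | h
    · refine (f2.not_subset_pair hfin N B fun x hx => ?_).elim
      simp only [Set.mem_insert_iff, Set.mem_singleton_iff] at hx ⊢
      tauto
    · exact h
  obtain ⟨iDA, rfl⟩ : inner ℝ D A = 0 ∧ E = D + A - N := by
    rcases sq'.degenerate_or n_N n_D (hnorm hE) n_A with ⟨rfl, rfl⟩ | h
    · refine (f4.not_subset_pair hfin N D fun x hx => ?_).elim
      simp only [Set.mem_insert_iff, Set.mem_singleton_iff] at hx ⊢
      tauto
    · exact h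
  have iNA := inner_of_angle n_N n_A tNA
  have iAB := inner_of_angle n_A n_B tAB
  have iBN := inner_of_angle n_B n_N tBN
  have iNC := inner_of_angle n_N n_C tNC
  have iCD := inner_of_angle n_C n_D tCD
  have iDN := inner_of_angle n_D n_N tDN
  have iAN := (real_inner_comm N A).trans iNA
  have iNB := (real_inner_comm B N).trans iBN
  have iCN := (real_inner_comm N C).trans iNC
  have iND := (real_inner_comm D N).trans iDN
  have iCB := (real_inner_comm B C).trans iBC
  have iBA := (real_inner_comm A B).trans iAB
  have iDC := (real_inner_comm C D).trans iCD
  have hNN : inner ℝ N N = 1 := by rw [real_inner_self_eq_norm_sq, n_N]; norm_num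
  have hBB : inner ℝ B B = 1 := by rw [real_inner_self_eq_norm_sq, n_B]; norm_num
  have hCC : inner ℝ C C = 1 := by rw [real_inner_self_eq_norm_sq, n_C]; norm_num
  have h22 : √2 * √2 = 2 := Real.mul_self_sqrt (by norm_num)
  -- `W` = B + C - N gives the axis; taking -N as the second vector puts the star around longitude
  -- ±π and the five unknown points around longitude 0.
  have horth : Orthonormal ℝ ![B + C - N, -N, (√2 / 2) • (B - C)] := by
    refine orthonormal_fin_three n_W (by rwa [norm_neg]) ?_ ?_ ?_ ?_
    · refine (pow_eq_one_iff_of_nonneg (norm_nonneg _) two_ne_zero).1 ?_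
      rw [← real_inner_self_eq_norm_sq]
      simp only [inner_sub_left, inner_sub_right, real_inner_smul_left, inner_smul_right, hBB, hCC, iBC, iCB]
      linarith
    all_goals
      simp only [inner_sub_left, inner_sub_right, inner_add_left, inner_neg_left, inner_neg_right,
        inner_smul_right, hNN, hBB, hCC, iBC, iCB, iBN, iNB, iCN, iNC]
      ring
  obtain ⟨g, hg⟩ := exists_isometry_of_orthonormal horth
  have hvec : ∀ x : E3, g x = !₂[inner ℝ (B + C - N) x, inner ℝ (-N) x,
      inner ℝ ((√2 / 2) • (B - C)) x] := by
    intro x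
    ext i
    rw [hg]
    fin_cases i <;> simp
  have gN : g N = !₂[0, -1, 0] := by
    rw [hvec]
    simp only [inner_sub_left, inner_add_left, inner_neg_left, real_inner_smul_left, hNN, iBN, iCN]
    exact vec_eq (by ring) rfl (by ring)
  have gB : g B = !₂[1 / 2, -1 / 2, √2 / 2] := by
    rw [hvec]
    simp only [inner_sub_left, inner_add_left, inner_neg_left, real_inner_smul_left, hBB, iNB, iCB]
    exact vec_eq (by ring) (by ring) (by ring)
  have gC : g C = !₂[1 / 2, -1 / 2, -√2 / 2] := by
    rw [hvec]
    simp only [inner_sub_left, inner_add_left, inner_neg_left, real_inner_smul_left, hCC, iNC, iBC]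
    exact vec_eq (by ring) (by ring) (by ring)
  have gW : g (B + C - N) = !₂[1, 0, 0] := by
    rw [map_sub, map_add, gB, gC, gN]
    ext i
    fin_cases i <;> simp <;> ring
  have hAC : inner ℝ A C ≤ 1 / 2 := hle hA hC (by rintro rfl; linarith)
  have hDB : inner ℝ D B ≤ 1 / 2 := hle hD hB (by rintro rfl; linarith)
  have gA : g A = !₂[-1 / 2, -1 / 2, √2 / 2] := by
    rw [star_vertex_eq (x := g A) (ε := 1) (.inl rfl) (by rw [g.norm_map, n_A])]
    · rw [one_mul]
    · rw [hvec]
      simp [inner_neg_left, iNA]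
      norm_num
    · rw [one_mul, ← gB, g.inner_map_map, iAB]
    · rw [one_mul, ← neg_div, ← gC, g.inner_map_map]
      exact hAC
  have gD : g D = !₂[-1 / 2, -1 / 2, -√2 / 2] := by
    rw [star_vertex_eq (x := g D) (ε := -1) (.inr rfl) (by rw [g.norm_map, n_D])]
    · simp only [neg_one_mul, neg_div]
    · rw [hvec]
      simp [inner_neg_left, iND]
      norm_num
    · rw [neg_one_mul, ← neg_div, ← gC, g.inner_map_map, iDC]
    · rw [neg_one_mul, neg_neg, ← gB, g.inner_map_map]
      exact hDB
  have gE : g (D + A - N) = !₂[-1, 0, 0] := by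
    rw [map_sub, map_add, gA, gD, gN]
    ext i
    fin_cases i <;> simp
    ring
  refine ⟨g, ?_⟩
  rintro _ (rfl | rfl | rfl | rfl | rfl | rfl | rfl)
  exacts [⟨_, hW, gW⟩, ⟨_, hE, gE⟩, ⟨_, hN, gN⟩, ⟨_, hB, gB⟩, ⟨_, hA, gA⟩, ⟨_, hC, gC⟩, ⟨_, hD, gD⟩]

theorem CongruentOnSphere.of_image {S T : Set E3} (g : E3 ≃ₗᵢ[ℝ] E3)
    (h : CongruentOnSphere (g '' S) T) : CongruentOnSphere S T := by
  obtain ⟨h, hh⟩ := h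
  refine ⟨h.trans g.symm, ?_⟩
  rw [LinearIsometryEquiv.coe_trans, Set.image_comp, hh, ← Set.image_comp]
  simp

theorem mainTheorem7 (S : Set E3) (hS : IsTypeI S) (hstar : ∃ N ∈ S, IsStarTSTS S N) :
    CongruentOnSphere S fccConfig ∨ CongruentOnSphere S hcpConfig := by
  obtain ⟨N, hN, hstar⟩ := hstar
  obtain ⟨g, hg⟩ := exists_isometry_frame hS hN hstar
  obtain ⟨hsph, hcard, hdist⟩ := hS
  have hnorm : ∀ {x}, x ∈ S → ‖x‖ = 1 := fun hx => by simpa using hsph hx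
  have hclass := union_classification (S := g '' S)
    (by rintro _ ⟨x, hx, rfl⟩; rw [g.norm_map, hnorm hx])
    (by rw [Set.ncard_image_of_injective _ g.injective, hcard])
    (by
      rintro _ ⟨x, hx, rfl⟩ _ ⟨y, hy, rfl⟩ hxy
      rw [g.inner_map_map]
      exact inner_le_of_angle (hnorm hx) (hnorm hy) (hdist hx hy (fun h => hxy (by rw [h]))))
    hg
  rcases hclass with h | h | h
  · left
    refine .of_image g ?_
    rw [h]
    exact congruent_fcc
  · right
    refine .of_image g ?_
    rw [h]
    exact congruent_hcp (.inl rfl)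
  · right
    refine .of_image g ?_
    rw [h]
    exact congruent_hcp (.inr rfl)
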